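/- Let $n\ge 5$, $N\ge 2$. Let $\mathbb{R}^N\otimes\mathbb{S}(n)$ be the space of real arrays $X=(X_{\alpha ij})$, $1\le\alpha\le N$, $1\le i,j\le n$, with $X_{\alpha ij}=X_{\alpha ji}$; all norms $|\cdot|$ are Euclidean. For a real tensor $A=(A_{\alpha\beta ij})$ with $A_{\alpha\beta ij}=A_{\beta\alpha ji}$ (i.e. $A\in\mathbb{S}(N\times n)$) put $$(A:Z)_\alpha=\sum_{\beta,i,j}A_{\alpha\beta ij}Z_{\beta ij},\qquad \nu(A)=\min_{|\eta|=|a|=1}\ \sum_{\alpha,\beta,i,j}A_{\alpha\beta ij}\,\eta_\alpha a_i\,\eta_\beta a_j\qquad(\eta\in\mathbb{R}^N,\ a\in\mathbb{R}^n),$$ and call $A$ rank-one positive if $\sum A_{\alpha\beta ij}\eta_\alpha a_i\eta_\beta a_j\ge\nu|\eta|^2|a|^2$ for some $\nu>0$ and all $\eta\in\mathbb{R}^N$, $a\in\mathbb{R}^n$. Let $$W^{2,2}_*(\mathbb{R}^n)^N=\{u\in L^{2^{**}}(\mathbb{R}^n)^N:\ Du\in L^{2^*}(\mathbb{R}^n)^{Nn},\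 D^2u\in L^2(\mathbb{R}^n)^{Nn^2}\},\qquad 2^*=\tfrac{2n}{n-2},\quad 2^{**}=\tfrac{2n}{n-4},$$ with weak derivatives and the norm $\|u\|_{W^{2,2}_*}=\|u\|_{L^{2^{**}}}+\|Du\|_{L^{2^*}}+\|D^2u\|_{L^2}$. Let $F:\mathbb{R}^n\times(\mathbb{R}^N\otimes\mathbb{S}(n))\to\mathbb{R}^N$ be a Carathéodory map (measurable in $x$ for every $X$, continuous in $X$ for a.e. $x$) with $F(\cdot,0)=0$ a.e. on $\mathbb{R}^n$, satisfying the K-condition: there exist a rank-one positive $A\in\mathbb{S}(N\times n)$, a function $\alpha\in L^\infty(\mathbb{R}^n)$ with $\alpha>0$ a.e. and $1/\alpha\in L^\infty(\mathbb{R}^n)$, and $\beta,\gamma>0$ with $\beta+\gamma<1$, such that for a.e. $x\in\mathbb{R}^n$ and all $X,Z\in\mathbb{R}^N\otimes\mathbb{S}(n)$ $$\big|A:Z-\alpha(x)\big(F(x,X+Z)-F(x,X)\big)\big|^2\le\beta\,\nu(A)^2|Z|^2+\gamma\,|A:Z|^2.$$ Then there is a constant $C>0$, depending only on $F$, $n$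 and $N$, such that: 1. For every $f\in L^2(\mathbb{R}^n)^N$ the system $F(\cdot,D^2u)=f$ a.e. on $\mathbb{R}^n$ has a unique strong solution $u\in W^{2,2}_*(\mathbb{R}^n)^N$, and $\|u\|_{L^{2^{**}}}+\|Du\|_{L^{2^*}}+\|D^2u\|_{L^2}\le C\|f\|_{L^2}$. 2. For all $w,v\in W^{2,2}_*(\mathbb{R}^n)^N$ one has $F(\cdot,D^2w)-F(\cdot,D^2v)\in L^2(\mathbb{R}^n)^N$ and $$\|w-v\|_{W^{2,2}_*}\le C\,\|F(\cdot,D^2w)-F(\cdot,D^2v)\|_{L^2}.$$ -/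

import Mathlib

open MeasureTheory
open scoped ENNReal ContDiff

noncomputable section

/-- The space `ℝ^N ⊗ 𝕊(n)` of arrays `X_{αij}` that are symmetric in `i, j`, as a subspace of
`ℝ^{N n²}`; it inherits the Euclidean norm `|X|² = ∑ X_{αij}²`. -/
def symTensor (N n : ℕ) : Submodule ℝ (EuclideanSpace ℝ (Fin N × Fin n × Fin n)) where
  carrier := {X | ∀ α i j, X (α, i, j) = X (α, j, i)}
  add_mem' := by
    intro X Y hX hY α i j
    simp only [PiLp.add_apply]
    rw [hX α i j, hY α i j]
  zero_mem' := by
    intro α i j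
    simp
  smul_mem' := by
    intro c X hX α i j
    simp only [PiLp.smul_apply]
    rw [hX α i j]

/-- The type of fourth order tensors `A_{αβij}`, `1 ≤ α, β ≤ N`, `1 ≤ i, j ≤ n`. -/
abbrev FourTensor (N n : ℕ) : Type := Fin N → Fin N → Fin n → Fin n → ℝ

namespace FourTensor

variable {N n : ℕ}

/-- `A ∈ 𝕊(N × n)`, i.e. `A_{αβij} = A_{βαji}`. -/
def IsSymm (A : FourTensor N n) : Prop :=
  ∀ α β i j, A α β i j = A β α j i

/-- `A : η ⊗ a ⊗ η ⊗ a = A_{αβij} η_α a_i η_β a_j`. -/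
def rankOneForm (A : FourTensor N n) (η : EuclideanSpace ℝ (Fin N))
    (a : EuclideanSpace ℝ (Fin n)) : ℝ :=
  ∑ α, ∑ β, ∑ i, ∑ j, A α β i j * η α * a i * η β * a j

/-- `A` is rank-one positive: `A : η ⊗ a ⊗ η ⊗ a ≥ ν |η|² |a|²` for some `ν > 0`. -/
def RankOnePositive (A : FourTensor N n) : Prop :=
  ∃ ν : ℝ, 0 < ν ∧ ∀ (η : EuclideanSpace ℝ (Fin N)) (a : EuclideanSpace ℝ (Fin n)),
    ν * ‖η‖ ^ 2 * ‖a‖ ^ 2 ≤ A.rankOneForm η a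

/-- The ellipticity constant `ν(A) = min_{|η| = |a| = 1} A : η ⊗ a ⊗ η ⊗ a`. -/
def ellipticityConst (A : FourTensor N n) : ℝ :=
  sInf {q : ℝ | ∃ (η : EuclideanSpace ℝ (Fin N)) (a : EuclideanSpace ℝ (Fin n)),
    ‖η‖ = 1 ∧ ‖a‖ = 1 ∧ q = A.rankOneForm η a}

/-- The contraction `A : Z = (A_{αβij} Z_{βij}) e^α ∈ ℝ^N`. -/
def contract (A : FourTensor N n) (Z : symTensor N n) : EuclideanSpace ℝ (Fin N) :=
  WithLp.toLp 2 fun α => ∑ β, ∑ i, ∑ j, A α β i j * Z.1 (β, i, j)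

end FourTensor

section System

variable {N n : ℕ}

/-- Carathéodory maps `F : ℝⁿ × (ℝ^N ⊗ 𝕊(n)) → ℝ^N`: (Lebesgue) measurable in the first variable,
continuous in the second one for almost every value of the first. -/
def IsCaratheodory
    (F : EuclideanSpace ℝ (Fin n) → symTensor N n → EuclideanSpace ℝ (Fin N)) : Prop :=
  (∀ X, AEStronglyMeasurable (fun x => F x X) volume) ∧ ∀ᵐ x ∂volume, Continuous (F x)

/-- The K-condition on `Ω = ℝⁿ`. -/
def KCondition
    (F : EuclideanSpace ℝ (Fin n) → symTensor N n → EuclideanSpace ℝ (Fin N)) : Prop :=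
  ∃ (A : FourTensor N n) (α : EuclideanSpace ℝ (Fin n) → ℝ) (β γ : ℝ),
    A.IsSymm ∧ A.RankOnePositive ∧
    MemLp α ∞ volume ∧ (∀ᵐ x ∂volume, 0 < α x) ∧ MemLp (fun x => 1 / α x) ∞ volume ∧
    0 < β ∧ 0 < γ ∧ β + γ < 1 ∧
    ∀ᵐ x ∂volume, ∀ X Z : symTensor N n,
      ‖A.contract Z - α x • (F x (X + Z) - F x X)‖ ^ 2
        ≤ β * A.ellipticityConst ^ 2 * ‖Z‖ ^ 2 + γ * ‖A.contract Z‖ ^ 2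

/-- `g` is the weak partial derivative `D_i u` on `ℝⁿ`. -/
def IsWeakPartial (i : Fin n) (u g : EuclideanSpace ℝ (Fin n) → ℝ) : Prop :=
  LocallyIntegrable u volume ∧ LocallyIntegrable g volume ∧
  ∀ φ : EuclideanSpace ℝ (Fin n) → ℝ, ContDiff ℝ ∞ φ → HasCompactSupport φ →
    ∫ x, u x * fderiv ℝ φ x (EuclideanSpace.single i 1) = - ∫ x, g x * φ x

/-- `2^* = 2n / (n - 2)`. -/
def twoStar (n : ℕ) : ℝ≥0∞ := ENNReal.ofReal (2 * (n : ℝ) / ((n : ℝ) - 2))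

/-- `2^{**} = 2n / (n - 4)`. -/
def twoStarStar (n : ℕ) : ℝ≥0∞ := ENNReal.ofReal (2 * (n : ℝ) / ((n : ℝ) - 4))

/-- `u ∈ W^{2,2}_*(ℝⁿ)^N` with weak gradient `Du = G` and weak hessian `D²u = H`, where
`G_{αi} = D_i u_α` and `H_{αij} = D_j D_i u_α`. As weak second derivatives commute, it is no
restriction to take the representative `H` with values in `ℝ^N ⊗ 𝕊(n)`. -/
structure IsW22Star (u : EuclideanSpace ℝ (Fin n) → EuclideanSpace ℝ (Fin N))
    (G : EuclideanSpace ℝ (Fin n) → EuclideanSpace ℝ (Fin N × Fin n))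
    (H : EuclideanSpace ℝ (Fin n) → symTensor N n) : Prop where
  memLp_fun : MemLp u (twoStarStar n) volume
  memLp_grad : MemLp G (twoStar n) volume
  memLp_hess : MemLp H 2 volume
  weak_grad : ∀ α i, IsWeakPartial i (fun x => u x α) (fun x => G x (α, i))
  weak_hess : ∀ α i j, IsWeakPartial j (fun x => G x (α, i)) (fun x => (H x).1 (α, i, j))

/-- The norm `‖u‖_{L^{2**}} + ‖Du‖_{L^{2*}} + ‖D²u‖_{L²}` of `W^{2,2}_*(ℝⁿ)^N`, for `Du = G` and
`D²u = H`. -/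
def w22StarNorm (u : EuclideanSpace ℝ (Fin n) → EuclideanSpace ℝ (Fin N))
    (G : EuclideanSpace ℝ (Fin n) → EuclideanSpace ℝ (Fin N × Fin n))
    (H : EuclideanSpace ℝ (Fin n) → symTensor N n) : ℝ≥0∞ :=
  eLpNorm u (twoStarStar n) volume + eLpNorm G (twoStar n) volume + eLpNorm H 2 volume

/-- `u ∈ W^{2,2}_*(ℝⁿ)^N`, with `Du = G` and `D²u = H`, is a strong solution of
`F(·, D²u) = f` a.e. on `ℝⁿ`. -/
def IsStrongSolution (F : EuclideanSpace ℝ (Fin n) → symTensor N n → EuclideanSpace ℝ (Fin N))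
    (f u : EuclideanSpace ℝ (Fin n) → EuclideanSpace ℝ (Fin N))
    (G : EuclideanSpace ℝ (Fin n) → EuclideanSpace ℝ (Fin N × Fin n))
    (H : EuclideanSpace ℝ (Fin n) → symTensor N n) : Prop :=
  IsW22Star u G H ∧ ∀ᵐ x ∂volume, F x (H x) = f x

end System

end

/-!
The system `F(·, D²u) = f` is solved by comparison with the linear system `A : D²u = f`, in the
manner of Campanato's near operators.

*Linear theory.* If `u ∈ W^{2,2}_*`, the Fourier transform of `D²u` is of the form
`ξ ⊗ ξ ⊗ m(ξ)` (`IsW22Star.realFourier_hess`). On such arrays rank-one positivity reads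
`ν |ξ ⊗ ξ ⊗ m| ≤ |A : ξ ⊗ ξ ⊗ m|`, so Plancherel's theorem gives `ν ‖D²u‖ ≤ ‖A : D²u‖` in `L²`
(`IsW22Star.mul_eLpNorm_hess_le`). The range of `A : D²` on test functions is dense in `L²`, because
the Fourier transform of an element of its orthogonal complement is annihilated by the positive
matrices `(∑ A_{αβij} ξ_i ξ_j)_{αβ}` (`FourTensor.denseRange_testOperator`). Approximation by test
functions, with the Gagliardo-Nirenberg-Sobolev inequality applied twice, produces for each
`f ∈ L²` a solution in `W^{2,2}_*` whose full norm is bounded by `‖f‖`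
(`FourTensor.exists_isW22Star_contract_eq`). An element of `W^{2,2}_*` with vanishing hessian is
zero (`IsW22Star.ae_eq_zero_of_hess`), so this solution is the only one, and the bound holds on all
of `W^{2,2}_*` (`FourTensor.exists_w22StarNorm_le`); in this way the Sobolev inequality for weakly
differentiable functions is obtained without cutting off or mollifying them.

*Nonlinear problem.* Integrating the `K`-condition and inserting `ν ‖D²u‖ ≤ ‖A : D²u‖` shows that
`A : D² - α F(·, D²)` is Lipschitz relative to `A : D²`, with constant `√(β + γ) < 1`
(`eLpNorm_contract_sub_le`). Hence `‖A : D²(w - v)‖` is bounded by a multiple of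
`‖F(·, D²w) - F(·, D²v)‖`, which is the comparison estimate and contains uniqueness. Existence is
Banach's fixed point theorem for `g ↦ A : D²u_g - α (F(·, D²u_g) - f)` in `L²`, where `u_g` solves
`A : D²u_g = g` (`exists_isStrongSolution`).
-/

noncomputable section

/-! ### Partial derivatives of smooth functions -/

/-- The partial derivative `∂_i φ` of a vector-valued function on `ℝⁿ`. -/
def partialDeriv {n : ℕ} {V : Type*} [NormedAddCommGroup V] [NormedSpace ℝ V] (i : Fin n)
    (φ : EuclideanSpace ℝ (Fin n) → V) : EuclideanSpace ℝ (Fin n) → V :=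
  fun x => fderiv ℝ φ x (EuclideanSpace.single i 1)

section PartialDeriv

variable {n : ℕ} {V W : Type*} [NormedAddCommGroup V] [NormedSpace ℝ V]
  [NormedAddCommGroup W] [NormedSpace ℝ W] {φ ψ : EuclideanSpace ℝ (Fin n) → V}

theorem ContDiff.partialDeriv (hφ : ContDiff ℝ ∞ φ) (i : Fin n) :
    ContDiff ℝ ∞ (partialDeriv i φ) :=
  (hφ.fderiv_right (m := ∞) (by simp)).clm_apply contDiff_const

theorem HasCompactSupport.partialDeriv (hφ : HasCompactSupport φ) (i : Fin n) :
    HasCompactSupport (partialDeriv i φ) :=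
  hφ.fderiv_apply ℝ _

theorem partialDeriv_comm (hφ : ContDiff ℝ ∞ φ) (i j : Fin n) :
    partialDeriv i (partialDeriv j φ) = partialDeriv j (partialDeriv i φ) := by
  have key : ∀ (v w x : EuclideanSpace ℝ (Fin n)),
      fderiv ℝ (fun y => fderiv ℝ φ y w) x v = fderiv ℝ (fderiv ℝ φ) x v w := by
    intro v w x
    have hd : DifferentiableAt ℝ (fderiv ℝ φ) x :=
      (hφ.fderiv_right (m := ∞) (by simp)).differentiable (by simp) x
    rw [fderiv_clm_apply hd (differentiableAt_const w)]
    simp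
  have hs : ∀ x, IsSymmSndFDerivAt ℝ φ x := fun x =>
    (contDiff_infty.1 hφ 2).contDiffAt.isSymmSndFDerivAt (by simp)
  funext x
  unfold partialDeriv
  rw [key, key]
  exact hs x _ _

theorem partialDeriv_clm_comp (L : V →L[ℝ] W) (hφ : ContDiff ℝ ∞ φ) (i : Fin n) :
    partialDeriv i (fun x => L (φ x)) = fun x => L (partialDeriv i φ x) := by
  funext x
  have := fderiv_comp x L.differentiableAt (hφ.differentiable (by simp) x)
  unfold partialDeriv
  have h2 : (fun x => L (φ x)) = L ∘ φ := rfl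
  rw [h2, this]
  simp

theorem partialDeriv_add (hφ : ContDiff ℝ ∞ φ) (hψ : ContDiff ℝ ∞ ψ) (i : Fin n) :
    partialDeriv i (fun x => φ x + ψ x) = fun x => partialDeriv i φ x + partialDeriv i ψ x := by
  funext x
  unfold partialDeriv
  rw [fderiv_fun_add (hφ.differentiable (by simp) x) (hψ.differentiable (by simp) x)]
  simp

theorem partialDeriv_const_smul (c : ℝ) (hφ : ContDiff ℝ ∞ φ) (i : Fin n) :
    partialDeriv i (fun x => c • φ x) = fun x => c • partialDeriv i φ x := by
  funext x
  unfold partialDeriv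
  rw [fderiv_fun_const_smul (hφ.differentiable (by simp) x)]
  simp

theorem partialDeriv_smul {χ : EuclideanSpace ℝ (Fin n) → ℝ} (hχ : ContDiff ℝ ∞ χ)
    (hφ : ContDiff ℝ ∞ φ) (i : Fin n) :
    partialDeriv i (fun x => χ x • φ x) =
      fun x => χ x • partialDeriv i φ x + partialDeriv i χ x • φ x := by
  funext x
  unfold partialDeriv
  rw [fderiv_fun_smul (hχ.differentiable (by simp) x) (hφ.differentiable (by simp) x)]
  simp

theorem partialDeriv_comp_smul (c : ℝ) (hφ : ContDiff ℝ ∞ φ) (i : Fin n) :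
    partialDeriv i (fun x => φ (c • x)) = fun x => c • partialDeriv i φ (c • x) := by
  funext x
  unfold partialDeriv
  have h := ((hφ.differentiable (by simp) (c • x)).hasFDerivAt).comp x
    ((hasFDerivAt_id x).const_smul c)
  have h2 : fderiv ℝ (fun x => φ (c • x)) x = _ := h.fderiv
  rw [h2]
  simp

/-- Integration by parts. -/
theorem integral_mul_partialDeriv {f g : EuclideanSpace ℝ (Fin n) → ℝ} (hf : ContDiff ℝ ∞ f)
    (hg : ContDiff ℝ ∞ g) (hgc : HasCompactSupport g) (i : Fin n) :
    ∫ x, f x * partialDeriv i g x = - ∫ x, partialDeriv i f x * g x := by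
  have hg' := hg.partialDeriv i
  have hf' := hf.partialDeriv i
  refine integral_mul_fderiv_eq_neg_fderiv_mul_of_integrable ?_ ?_ ?_
    (fun x _ => hf.differentiable (by simp) x) (fun x _ => hg.differentiable (by simp) x)
  · exact (hf'.continuous.mul hg.continuous).integrable_of_hasCompactSupport hgc.mul_left
  · exact (hf.continuous.mul hg'.continuous).integrable_of_hasCompactSupport
      (hgc.partialDeriv i).mul_left
  · exact (hf.continuous.mul hg.continuous).integrable_of_hasCompactSupport hgc.mul_left

end PartialDeriv

/-! ### Second order equations satisfied by square-integrable functions -/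

section DoubleDiv

variable {n : ℕ} {ι : Type*} [Fintype ι] {p q : ι → Fin n}

theorem memLp_mul_integrable {h : EuclideanSpace ℝ (Fin n) → ℂ} (hh : MemLp h 2 volume)
    {g : EuclideanSpace ℝ (Fin n) → ℂ} (hg : MemLp g 2 volume) :
    Integrable (fun x => h x * g x) volume :=
  hh.integrable_mul hg

/-- An equation tested against real test functions may be tested against complex ones. -/
theorem sum_integral_eq_zero_complex {h : ι → EuclideanSpace ℝ (Fin n) → ℝ}
    (hh : ∀ s, MemLp (h s) 2 volume)
    (h0 : ∀ φ : EuclideanSpace ℝ (Fin n) → ℝ, ContDiff ℝ ∞ φ → HasCompactSupport φ →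
      ∑ s, ∫ x, h s x * partialDeriv (p s) (partialDeriv (q s) φ) x = 0)
    {φ : EuclideanSpace ℝ (Fin n) → ℂ} (hφ : ContDiff ℝ ∞ φ) (hc : HasCompactSupport φ) :
    ∑ s, ∫ x, (h s x : ℂ) * partialDeriv (p s) (partialDeriv (q s) φ) x = 0 := by
  have hint : ∀ s, Integrable (fun x => (h s x : ℂ) * partialDeriv (p s) (partialDeriv (q s) φ) x)
      volume := fun s => memLp_mul_integrable (hh s).ofReal
    (((hφ.partialDeriv (q s)).partialDeriv (p s)).continuous.memLp_of_hasCompactSupport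
      ((hc.partialDeriv (q s)).partialDeriv (p s)))
  have key : ∀ L : ℂ →L[ℝ] ℝ, (∀ (r : ℝ) (z : ℂ), L (r * z) = r * L z) →
      L (∑ s, ∫ x, (h s x : ℂ) * partialDeriv (p s) (partialDeriv (q s) φ) x) = 0 := by
    intro L hL
    have := h0 (fun x => L (φ x)) (L.contDiff.comp hφ) (hc.comp_left (map_zero L))
    rw [map_sum, ← this]
    refine Finset.sum_congr rfl fun s _ => ?_
    rw [← L.integral_comp_comm (hint s)]
    simp only [hL]
    rw [partialDeriv_clm_comp L hφ, partialDeriv_clm_comp L (hφ.partialDeriv (q s))]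
  apply Complex.ext
  · simpa using key Complex.reCLM (by simp)
  · simpa using key Complex.imCLM (by simp)

theorem tendsto_integral_cutoff {h θ : EuclideanSpace ℝ (Fin n) → ℂ}
    (hhθ : Integrable (fun x => h x * θ x) volume) {b : EuclideanSpace ℝ (Fin n) → ℝ}
    (hb : Continuous b) (hbc : HasCompactSupport b) :
    Filter.Tendsto (fun k : ℕ => ∫ x, h x * (b (((k : ℝ) + 1)⁻¹ • x) • θ x)) Filter.atTop
      (nhds (b 0 • ∫ x, h x * θ x)) := by
  obtain ⟨C, hC⟩ := hbc.exists_bound_of_continuous hb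
  rw [← integral_smul]
  have e : ∀ k : ℕ, (fun x => h x * (b (((k : ℝ) + 1)⁻¹ • x) • θ x)) =
      fun x => b (((k : ℝ) + 1)⁻¹ • x) • (h x * θ x) := by
    intro k; funext x; rw [mul_smul_comm]
  simp only [e]
  refine tendsto_integral_of_dominated_convergence (fun x => C * ‖h x * θ x‖) ?_ ?_ ?_ ?_
  · intro k
    exact ((hb.comp (continuous_const_smul _)).aestronglyMeasurable).smul hhθ.1
  · exact hhθ.norm.const_mul C
  · intro k
    filter_upwards with x
    rw [norm_smul]
    gcongr
    exact hC _
  · filter_upwards with x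
    have h1 : Filter.Tendsto (fun k : ℕ => (((k : ℝ) + 1)⁻¹ • x)) Filter.atTop (nhds 0) := by
      have : Filter.Tendsto (fun k : ℕ => ((k : ℝ) + 1)⁻¹) Filter.atTop (nhds 0) := by
        simpa [one_div] using tendsto_one_div_add_atTop_nhds_zero_nat (𝕜 := ℝ)
      simpa using this.smul_const x
    exact ((hb.tendsto 0).comp h1).smul_const _

/-- Schwartz functions are admissible test functions in a second order equation satisfied by `L²`
functions: cut off at scale `k + 1`; the terms in which a derivative falls on the cut-off carry a
negative power of `k + 1`. -/
theorem sum_integral_eq_zero_schwartz {h : ι → EuclideanSpace ℝ (Fin n) → ℝ}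
    (hh : ∀ s, MemLp (h s) 2 volume)
    (h0 : ∀ φ : EuclideanSpace ℝ (Fin n) → ℝ, ContDiff ℝ ∞ φ → HasCompactSupport φ →
      ∑ s, ∫ x, h s x * partialDeriv (p s) (partialDeriv (q s) φ) x = 0)
    (ψ : SchwartzMap (EuclideanSpace ℝ (Fin n)) ℂ) :
    ∑ s, ∫ x, (h s x : ℂ) * partialDeriv (p s) (partialDeriv (q s) ψ) x = 0 := by
  let bmp : ContDiffBump (0 : EuclideanSpace ℝ (Fin n)) := ⟨1, 2, one_pos, one_lt_two⟩
  let χ : EuclideanSpace ℝ (Fin n) → ℝ := bmp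
  have hχ : ContDiff ℝ ∞ χ := bmp.contDiff
  have hχc : HasCompactSupport χ := bmp.hasCompactSupport
  have hχ0 : χ 0 = 1 := bmp.one_of_mem_closedBall (by simp [bmp])
  have hψ : ContDiff ℝ ∞ ψ := ψ.smooth'
  have hm0 : MemLp (ψ : EuclideanSpace ℝ (Fin n) → ℂ) 2 volume := ψ.memLp 2 volume
  have hm1 : ∀ i, MemLp (partialDeriv i ψ) 2 volume := fun i =>
    (LineDeriv.lineDerivOp (EuclideanSpace.single i (1 : ℝ)) ψ).memLp 2 volume
  have hm2 : ∀ i j, MemLp (partialDeriv i (partialDeriv j ψ)) 2 volume := fun i j =>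
    (LineDeriv.lineDerivOp (EuclideanSpace.single i (1 : ℝ))
      (LineDeriv.lineDerivOp (EuclideanSpace.single j (1 : ℝ)) ψ)).memLp 2 volume
  have hs : ∀ c : ℝ, ContDiff ℝ ∞ fun x : EuclideanSpace ℝ (Fin n) => c • x := fun c =>
    contDiff_id.const_smul c
  have hexp : ∀ (c : ℝ) (i j : Fin n),
      partialDeriv i (partialDeriv j fun x => χ (c • x) • ψ x) = fun x =>
        χ (c • x) • partialDeriv i (partialDeriv j ψ) x
        + c • (partialDeriv i χ (c • x) • partialDeriv j ψ x)
        + c • (partialDeriv j χ (c • x) • partialDeriv i ψ x)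
        + c • c • (partialDeriv i (partialDeriv j χ) (c • x) • ψ x) := by
    intro c i j
    have a1 : ContDiff ℝ ∞ fun x => χ (c • x) := hχ.comp (hs c)
    have a2 : ContDiff ℝ ∞ fun x => partialDeriv j χ (c • x) := (hχ.partialDeriv j).comp (hs c)
    rw [partialDeriv_smul a1 hψ, partialDeriv_comp_smul c hχ]
    have b1 : ContDiff ℝ ∞ fun x => χ (c • x) • partialDeriv j ψ x := a1.smul (hψ.partialDeriv j)
    have b2 : ContDiff ℝ ∞ fun x => (c • partialDeriv j χ (c • x)) • ψ x :=
      (a2.const_smul c).smul hψ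
    rw [partialDeriv_add b1 b2,
      partialDeriv_smul a1 (hψ.partialDeriv j), partialDeriv_comp_smul c hχ,
      partialDeriv_smul (a2.const_smul c) hψ, partialDeriv_const_smul c a2,
      partialDeriv_comp_smul c (hχ.partialDeriv j)]
    funext x
    simp only [smul_eq_mul, mul_smul]
    abel
  have hint : ∀ {s : ι} {θ : EuclideanSpace ℝ (Fin n) → ℂ}, MemLp θ 2 volume →
      Integrable (fun x => (h s x : ℂ) * θ x) volume := fun {s θ} hθ =>
    memLp_mul_integrable (hh s).ofReal hθ
  have hintb : ∀ {s : ι} {θ : EuclideanSpace ℝ (Fin n) → ℂ} {b : _ → ℝ} (c : ℝ),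
      MemLp θ 2 volume → Continuous b → HasCompactSupport b →
      Integrable (fun x => (h s x : ℂ) * (b (c • x) • θ x)) volume := by
    intro s θ b c hθ hb hbc
    obtain ⟨C, hC⟩ := hbc.exists_bound_of_continuous hb
    have := (hint (s := s) hθ).bdd_smul C (φ := fun x => b (c • x))
      ((hb.comp (continuous_const_smul c)).aestronglyMeasurable)
      (Filter.Eventually.of_forall fun x => hC _)
    refine this.congr (Filter.Eventually.of_forall fun x => ?_)
    simp
    ring
  have hc1 : ∀ i, Continuous (partialDeriv i χ) := fun i => (hχ.partialDeriv i).continuous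
  have hc2 : ∀ i j, Continuous (partialDeriv i (partialDeriv j χ)) := fun i j =>
    ((hχ.partialDeriv j).partialDeriv i).continuous
  have hk1 : ∀ i, HasCompactSupport (partialDeriv i χ) := fun i => hχc.partialDeriv i
  have hk2 : ∀ i j, HasCompactSupport (partialDeriv i (partialDeriv j χ)) := fun i j =>
    (hχc.partialDeriv j).partialDeriv i
  have hlim : ∀ s, Filter.Tendsto (fun k : ℕ => ∫ x, (h s x : ℂ) *
      partialDeriv (p s) (partialDeriv (q s) fun x => χ (((k : ℝ) + 1)⁻¹ • x) • ψ x) x) Filter.atTop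
      (nhds (∫ x, (h s x : ℂ) * partialDeriv (p s) (partialDeriv (q s) ψ) x)) := by
    intro s
    have hc0 : Filter.Tendsto (fun k : ℕ => ((k : ℝ) + 1)⁻¹) Filter.atTop (nhds 0) := by
      simpa [one_div] using tendsto_one_div_add_atTop_nhds_zero_nat (𝕜 := ℝ)
    have t1 := tendsto_integral_cutoff (hint (s := s) (hm2 (p s) (q s))) hχ.continuous hχc
    have t2 := hc0.smul (tendsto_integral_cutoff (hint (s := s) (hm1 (q s))) (hc1 (p s)) (hk1 (p s)))
    have t3 := hc0.smul (tendsto_integral_cutoff (hint (s := s) (hm1 (p s))) (hc1 (q s)) (hk1 (q s)))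
    have t4 := hc0.smul (hc0.smul
      (tendsto_integral_cutoff (hint (s := s) hm0) (hc2 (p s) (q s)) (hk2 (p s) (q s))))
    have t := ((t1.add t2).add t3).add t4
    simp only [hχ0, one_smul, zero_smul, add_zero] at t
    refine t.congr fun k => ?_
    rw [hexp]
    simp only [mul_add, mul_smul_comm]
    have i1 := hintb (s := s) ((k : ℝ) + 1)⁻¹ (hm2 (p s) (q s)) hχ.continuous hχc
    have i2 := (hintb (s := s) ((k : ℝ) + 1)⁻¹ (hm1 (q s)) (hc1 (p s)) (hk1 (p s))).smul
      ((k : ℝ) + 1)⁻¹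
    have i3 := (hintb (s := s) ((k : ℝ) + 1)⁻¹ (hm1 (p s)) (hc1 (q s)) (hk1 (q s))).smul
      ((k : ℝ) + 1)⁻¹
    have i4 := ((hintb (s := s) ((k : ℝ) + 1)⁻¹ hm0 (hc2 (p s) (q s)) (hk2 (p s) (q s))).smul
      ((k : ℝ) + 1)⁻¹).smul ((k : ℝ) + 1)⁻¹
    simp only [mul_smul_comm, Pi.smul_def] at i1 i2 i3 i4
    have s1 := integral_add i1 i2
    have s2 := integral_add (i1.add i2) i3
    have s3 := integral_add ((i1.add i2).add i3) i4
    simp only [Pi.add_apply] at s2 s3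
    rw [s3, s2, s1]
    simp only [integral_smul]
  have hsum : Filter.Tendsto (fun k : ℕ => ∑ s, ∫ x, (h s x : ℂ) *
      partialDeriv (p s) (partialDeriv (q s) fun x => χ (((k : ℝ) + 1)⁻¹ • x) • ψ x) x) Filter.atTop
      (nhds (∑ s, ∫ x, (h s x : ℂ) * partialDeriv (p s) (partialDeriv (q s) ψ) x)) :=
    tendsto_finsetSum _ fun s _ => hlim s
  refine tendsto_nhds_unique hsum (tendsto_const_nhds.congr fun k => ?_)
  have hk : ((k : ℝ) + 1)⁻¹ ≠ 0 := by positivity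
  exact (sum_integral_eq_zero_complex hh h0 ((hχ.comp (hs _)).smul hψ)
    ((hχc.comp_smul hk).smul_right)).symm

end DoubleDiv

/-! ### The Fourier transform of real square-integrable functions -/

section RealFourier

open FourierTransform LineDeriv

variable {n : ℕ} {ι : Type*} [Fintype ι] {p q : ι → Fin n}

/-- The Fourier transform of a real-valued function in `L²(ℝⁿ)`, a complex-valued function in
`L²(ℝⁿ)`. -/
def realFourier : Lp (α := EuclideanSpace ℝ (Fin n)) ℝ 2 →L[ℝ]
    Lp (α := EuclideanSpace ℝ (Fin n)) ℂ 2 :=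
  ((Lp.fourierTransformₗᵢ (EuclideanSpace ℝ (Fin n))
    ℂ).toContinuousLinearEquiv.toContinuousLinearMap.restrictScalars ℝ).comp
    (Complex.ofRealCLM.compLpL 2 volume)

theorem norm_realFourier (h : Lp (α := EuclideanSpace ℝ (Fin n)) ℝ 2) :
    ‖realFourier h‖ = ‖h‖ := by
  have h1 : ‖realFourier h‖ = ‖Complex.ofRealCLM.compLpL 2 volume h‖ :=
    (Lp.fourierTransformₗᵢ (EuclideanSpace ℝ (Fin n)) ℂ).norm_map _
  rw [h1, Lp.norm_def, Lp.norm_def]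
  congr 1
  refine eLpNorm_congr_norm_ae ?_
  filter_upwards [Complex.ofRealCLM.coeFn_compLpL (p := 2) (μ := volume) h] with x hx
  rw [hx]
  simp

theorem integral_fourier_mul_eq_integral_mul_realFourier
    (h : Lp (α := EuclideanSpace ℝ (Fin n)) ℝ 2)
    (Y : SchwartzMap (EuclideanSpace ℝ (Fin n)) ℂ) :
    ∫ x, (h x : ℂ) * (𝓕 Y) x = ∫ ξ, Y ξ * realFourier h ξ := by
  have h1 := congrArg (fun T => T Y)
    (Lp.fourier_toTemperedDistribution_eq (Complex.ofRealCLM.compLpL 2 volume h))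
  simp only [TemperedDistribution.fourier_apply, Lp.toTemperedDistribution_apply] at h1
  simp only [smul_eq_mul] at h1
  refine Eq.trans ?_ h1
  refine integral_congr_ae ?_
  filter_upwards [Complex.ofRealCLM.coeFn_compLpL (p := 2) (μ := volume) h] with x hx
  rw [hx, mul_comm]
  simp

theorem locallyIntegrable_mul_mul (i j : Fin n) (g : Lp (α := EuclideanSpace ℝ (Fin n)) ℂ 2) :
    LocallyIntegrable (fun ξ : EuclideanSpace ℝ (Fin n) => ((ξ i * ξ j : ℝ) : ℂ) * g ξ)
      volume := by
  have hg : LocallyIntegrable g volume :=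
    (Lp.memLp g).locallyIntegrable one_le_two
  have hc : Continuous fun ξ : EuclideanSpace ℝ (Fin n) => ((ξ i * ξ j : ℝ) : ℂ) := by fun_prop
  rw [locallyIntegrable_iff]
  intro K hK
  exact (hg.integrableOn_isCompact hK).continuousOn_mul hc.continuousOn hK

/-- A second order equation `∑ ∂_p ∂_q h = 0` in the sense of distributions between functions in
`L²` is the pointwise relation `∑ ξ_p ξ_q ĥ = 0` between their Fourier transforms. -/
theorem sum_mul_realFourier_eq_zero {h : ι → Lp (α := EuclideanSpace ℝ (Fin n)) ℝ 2}
    (h0 : ∀ φ : EuclideanSpace ℝ (Fin n) → ℝ, ContDiff ℝ ∞ φ → HasCompactSupport φ →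
      ∑ s, ∫ x, h s x * partialDeriv (p s) (partialDeriv (q s) φ) x = 0) :
    ∀ᵐ ξ : EuclideanSpace ℝ (Fin n),
      ∑ s, ((ξ (p s) * ξ (q s) : ℝ) : ℂ) * realFourier (h s) ξ = 0 := by
  have hloc : ∀ s, LocallyIntegrable (fun ξ : EuclideanSpace ℝ (Fin n) =>
      ((ξ (p s) * ξ (q s) : ℝ) : ℂ) * realFourier (h s) ξ) volume := fun s =>
    locallyIntegrable_mul_mul _ _ _
  refine ae_eq_zero_of_integral_contDiff_smul_eq_zero
    (locallyIntegrable_finsetSum _ fun s _ => hloc s) fun χ hχ hχc => ?_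
  let X : SchwartzMap (EuclideanSpace ℝ (Fin n)) ℂ :=
    (hχc.comp_left (g := ((↑) : ℝ → ℂ)) rfl).toSchwartzMap (Complex.ofRealCLM.contDiff.comp hχ)
  have hX : ∀ x, X x = χ x := fun x => rfl
  let Ψ : SchwartzMap (EuclideanSpace ℝ (Fin n)) ℂ := 𝓕 X
  have key : ∀ s, ∫ x, (h s x : ℂ) * partialDeriv (p s) (partialDeriv (q s) Ψ) x
      = (-(2 * Real.pi * Complex.I)) ^ 2 *
        ∫ ξ, χ ξ • (((ξ (p s) * ξ (q s) : ℝ) : ℂ) * realFourier (h s) ξ) := by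
    intro s
    have h1 : partialDeriv (p s) (partialDeriv (q s) Ψ) =
      (∂_{EuclideanSpace.single (p s) (1 : ℝ)} (∂_{EuclideanSpace.single (q s) (1 : ℝ)} Ψ) :
        SchwartzMap (EuclideanSpace ℝ (Fin n)) ℂ) := rfl
    rw [h1, show Ψ = 𝓕 X from rfl, SchwartzMap.lineDerivOp_fourier_eq, SchwartzMap.lineDerivOp_fourier_eq,
      integral_fourier_mul_eq_integral_mul_realFourier, ← integral_const_mul]
    refine integral_congr_ae (Filter.Eventually.of_forall fun ξ => ?_)
    have ht : ∀ m : EuclideanSpace ℝ (Fin n),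
      (fun x : EuclideanSpace ℝ (Fin n) => inner ℝ x m).HasTemperateGrowth := fun m => by fun_prop
    simp only [smul_apply, SchwartzMap.smulLeftCLM_apply (ht _), hX]
    simp [EuclideanSpace.inner_single_right]
    ring
  have hz := sum_integral_eq_zero_schwartz (fun s => Lp.memLp (h s)) h0 Ψ
  simp only [key, ← Finset.mul_sum] at hz
  have hz' := (mul_eq_zero.1 hz).resolve_left (by simp [Real.pi_ne_zero])
  simp only [Finset.smul_sum]
  rw [integral_finsetSum]
  · exact hz'
  · intro s _
    exact (hloc s).integrable_smul_left_of_hasCompactSupport hχ.continuous hχc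

end RealFourier

/-! ### The a priori estimate for the linear system -/

namespace FourTensor

variable {N n : ℕ}

/-- The contraction `Z ↦ A : Z` as a continuous linear map. -/
def contractCLM (A : FourTensor N n) : symTensor N n →L[ℝ] EuclideanSpace ℝ (Fin N) :=
  LinearMap.toContinuousLinearMap
    { toFun := A.contract
      map_add' := fun Z W => by
        ext α
        simp [contract, mul_add, Finset.sum_add_distrib]
      map_smul' := fun c Z => by
        ext α
        simp [contract, Finset.mul_sum, mul_left_comm] }

@[simp]
theorem contractCLM_apply (A : FourTensor N n) (Z : symTensor N n) :
    A.contractCLM Z = A.contract Z := rfl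

/-- Rank-one positivity bounds arrays of the form `ξ ⊗ ξ ⊗ m` by their contraction with `A`. -/
theorem sq_mul_sum_sq_le {A : FourTensor N n} {ν : ℝ} (hν : 0 < ν)
    (hA : ∀ (η : EuclideanSpace ℝ (Fin N)) (a : EuclideanSpace ℝ (Fin n)),
      ν * ‖η‖ ^ 2 * ‖a‖ ^ 2 ≤ A.rankOneForm η a)
    {ξ : EuclideanSpace ℝ (Fin n)} (hξ : ξ ≠ 0) {M : Fin N → Fin n → Fin n → ℝ}
    {m : Fin N → ℝ} (hM : ∀ β i j, ‖ξ‖ ^ 2 * M β i j = ξ i * ξ j * m β) :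
    ν ^ 2 * ∑ β, ∑ i, ∑ j, M β i j ^ 2 ≤ ∑ α, (∑ β, ∑ i, ∑ j, A α β i j * M β i j) ^ 2 := by
  have hξ0 : ‖ξ‖ ≠ 0 := norm_ne_zero_iff.2 hξ
  obtain ⟨a, ha, hMa⟩ : ∃ a : EuclideanSpace ℝ (Fin n), ‖a‖ = 1 ∧
      ∀ β i j, M β i j = a i * a j * m β := by
    refine ⟨‖ξ‖⁻¹ • ξ, by rw [norm_smul, norm_inv, norm_norm, inv_mul_cancel₀ hξ0], ?_⟩
    intro β i j
    have := hM β i j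
    simp only [PiLp.smul_apply, smul_eq_mul]
    field_simp
    linarith
  let η : EuclideanSpace ℝ (Fin N) := WithLp.toLp 2 m
  let y : EuclideanSpace ℝ (Fin N) :=
    WithLp.toLp 2 fun α => ∑ β, ∑ i, ∑ j, A α β i j * M β i j
  have hy : ∑ α, (∑ β, ∑ i, ∑ j, A α β i j * M β i j) ^ 2 = ‖y‖ ^ 2 := by
    rw [EuclideanSpace.real_norm_sq_eq]
  have hη : ∑ β, ∑ i, ∑ j, M β i j ^ 2 = ‖η‖ ^ 2 := by
    have h1 : ∑ i, a i ^ 2 = 1 := by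
      rw [← EuclideanSpace.real_norm_sq_eq, ha, one_pow]
    rw [EuclideanSpace.real_norm_sq_eq]
    refine Finset.sum_congr rfl fun β _ => ?_
    simp only [hMa, mul_pow, ← Finset.sum_mul, ← Finset.mul_sum, h1, one_mul, η]
  have hform : A.rankOneForm η a = inner ℝ η y := by
    simp only [rankOneForm, PiLp.inner_apply, η, y, hMa]
    refine Finset.sum_congr rfl fun α _ => ?_
    simp only [RCLike.inner_apply, conj_trivial, Finset.sum_mul]
    refine Finset.sum_congr rfl fun β _ => Finset.sum_congr rfl fun i _ =>
      Finset.sum_congr rfl fun j _ => ?_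
    ring
  have h1 := hA η a
  rw [ha, one_pow, mul_one, hform] at h1
  have h2 := real_inner_le_norm η y
  have h3 : ν * ‖η‖ ≤ ‖y‖ := by
    rcases (norm_nonneg η).eq_or_lt with h0 | h0
    · rw [← h0, mul_zero]; exact norm_nonneg y
    · nlinarith
  rw [hy, hη, ← mul_pow]
  exact pow_le_pow_left₀ (by positivity) h3 2

theorem sq_mul_sum_norm_sq_le {A : FourTensor N n} {ν : ℝ} (hν : 0 < ν)
    (hA : ∀ (η : EuclideanSpace ℝ (Fin N)) (a : EuclideanSpace ℝ (Fin n)),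
      ν * ‖η‖ ^ 2 * ‖a‖ ^ 2 ≤ A.rankOneForm η a)
    {ξ : EuclideanSpace ℝ (Fin n)} (hξ : ξ ≠ 0) {M : Fin N → Fin n → Fin n → ℂ}
    {m : Fin N → ℂ}
    (hM : ∀ β i j, ((‖ξ‖ ^ 2 : ℝ) : ℂ) * M β i j = ((ξ i * ξ j : ℝ) : ℂ) * m β) :
    ν ^ 2 * ∑ β, ∑ i, ∑ j, ‖M β i j‖ ^ 2 ≤
      ∑ α, ‖∑ β, ∑ i, ∑ j, (A α β i j : ℂ) * M β i j‖ ^ 2 := by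
  have hre := sq_mul_sum_sq_le hν hA hξ (M := fun β i j => (M β i j).re)
    (m := fun β => (m β).re) fun β i j => by
      have := congrArg Complex.re (hM β i j)
      rwa [Complex.re_ofReal_mul, Complex.re_ofReal_mul] at this
  have him := sq_mul_sum_sq_le hν hA hξ (M := fun β i j => (M β i j).im)
    (m := fun β => (m β).im) fun β i j => by
      have := congrArg Complex.im (hM β i j)
      rwa [Complex.im_ofReal_mul, Complex.im_ofReal_mul] at this
  have hsq : ∀ z : ℂ, ‖z‖ ^ 2 = z.re ^ 2 + z.im ^ 2 := fun z => by
    rw [← Complex.normSq_eq_norm_sq, Complex.normSq_apply]; ring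
  simp only [hsq, Finset.sum_add_distrib, Complex.re_sum, Complex.im_sum, Complex.re_ofReal_mul,
    Complex.im_ofReal_mul, mul_add]
  exact add_le_add hre him

end FourTensor

section Components

variable {N n : ℕ}

/-- The coordinate `Z_{αij}` as a continuous linear functional. -/
def symTensorCoord (α : Fin N) (i j : Fin n) : symTensor N n →L[ℝ] ℝ :=
  (EuclideanSpace.proj (α, i, j)).comp (symTensor N n).subtypeL

theorem norm_sq_symTensor (Z : symTensor N n) : ‖Z‖ ^ 2 = ∑ s, Z.1 s ^ 2 :=
  EuclideanSpace.real_norm_sq_eq Z.1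

theorem memLp_symTensor_coord {p : ℝ≥0∞} {H : EuclideanSpace ℝ (Fin n) → symTensor N n}
    (hH : MemLp H p volume) (s : Fin N × Fin n × Fin n) :
    MemLp (fun x => (H x).1 s) p volume :=
  hH.continuousLinearMap_comp (symTensorCoord s.1 s.2.1 s.2.2)

theorem coeFn_sum_smul {ι α V : Type*} [Fintype ι] [MeasurableSpace α] {μ : Measure α}
    [NormedAddCommGroup V] [NormedSpace ℝ V] {p : ℝ≥0∞} (c : ι → ℝ) (h : ι → Lp V p μ) :
    ⇑(∑ s, c s • h s) =ᵐ[μ] fun x => ∑ s, c s • h s x := by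
  refine (Lp.coeFn_finsetSum _ _).trans ?_
  filter_upwards [ae_all_iff.2 fun s => Lp.coeFn_smul (c s) (h s)] with x hx
  simp only [Finset.sum_apply, hx, Pi.smul_apply]

theorem integral_norm_sq_eq {α V : Type*} [MeasurableSpace α] {μ : Measure α}
    [NormedAddCommGroup V] {f : α → V} (hf : MemLp f 2 μ) :
    ∫ x, ‖f x‖ ^ 2 ∂μ = (eLpNorm f 2 μ).toReal ^ 2 := by
  have h0 : 0 ≤ ∫ x, ‖f x‖ ^ 2 ∂μ := integral_nonneg fun x => by positivity
  rw [hf.eLpNorm_eq_integral_rpow_norm two_ne_zero ENNReal.ofNat_ne_top]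
  have : ∀ x, ‖f x‖ ^ (2 : ℝ≥0∞).toReal = ‖f x‖ ^ 2 := fun x => by
    simp
  simp only [this]
  rw [ENNReal.toReal_ofReal (by positivity), ← Real.rpow_natCast, ← Real.rpow_mul h0]
  simp

theorem integral_sq_realFourier (f : Lp (α := EuclideanSpace ℝ (Fin n)) ℝ 2) :
    ∫ ξ, ‖realFourier f ξ‖ ^ 2 = ∫ x, f x ^ 2 := by
  have e1 := integral_norm_sq_eq (Lp.memLp (realFourier f))
  have e2 := integral_norm_sq_eq (Lp.memLp f)
  rw [← Lp.norm_def, norm_realFourier, Lp.norm_def, ← e2] at e1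
  simpa using e1

/-- The second weak derivatives commute with all second derivatives of test functions. -/
theorem IsW22Star.integral_hess_mul_comm {u G} {H : EuclideanSpace ℝ (Fin n) → symTensor N n}
    (hu : IsW22Star u G H) (α : Fin N) (i j k l : Fin n) {φ : EuclideanSpace ℝ (Fin n) → ℝ}
    (hφ : ContDiff ℝ ∞ φ) (hc : HasCompactSupport φ) :
    ∫ x, (H x).1 (α, i, j) * partialDeriv k (partialDeriv l φ) x =
      ∫ x, (H x).1 (α, k, l) * partialDeriv i (partialDeriv j φ) x := by
  have key : ∀ (i j : Fin n) {ψ : EuclideanSpace ℝ (Fin n) → ℝ}, ContDiff ℝ ∞ ψ →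
      HasCompactSupport ψ → ∫ x, (H x).1 (α, i, j) * ψ x =
        ∫ x, u x α * partialDeriv i (partialDeriv j ψ) x := by
    intro i j ψ hψ hψc
    have h1 := (hu.weak_hess α i j).2.2 ψ hψ hψc
    have h2 := (hu.weak_grad α i).2.2 _ (hψ.partialDeriv j) (hψc.partialDeriv j)
    have h3 : ∫ x, u x α * partialDeriv i (partialDeriv j ψ) x =
      -∫ x, G x (α, i) * partialDeriv j ψ x := h2
    have h4 : ∫ x, G x (α, i) * partialDeriv j ψ x = -∫ x, (H x).1 (α, i, j) * ψ x := h1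
    rw [h3, h4, neg_neg]
  rw [key i j ((hφ.partialDeriv l).partialDeriv k) ((hc.partialDeriv l).partialDeriv k),
    key k l ((hφ.partialDeriv j).partialDeriv i) ((hc.partialDeriv j).partialDeriv i)]
  rw [partialDeriv_comm (hφ.partialDeriv l) j k, partialDeriv_comm hφ j l,
    partialDeriv_comm ((hφ.partialDeriv j).partialDeriv l) i k,
    partialDeriv_comm (hφ.partialDeriv j) i l]

theorem ae_ne_zero_of_pos (hn : 0 < n) : ∀ᵐ ξ : EuclideanSpace ℝ (Fin n), ξ ≠ 0 := by
  have : Nontrivial (EuclideanSpace ℝ (Fin n)) := by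
    have : Nonempty (Fin n) := ⟨⟨0, hn⟩⟩
    infer_instance
  simp [ae_iff]

/-- The Fourier transform of `D²u` has the form `ξ ⊗ ξ ⊗ m(ξ)`. -/
theorem IsW22Star.realFourier_hess {u G} {H : EuclideanSpace ℝ (Fin n) → symTensor N n}
    (hu : IsW22Star u G H) :
    ∀ᵐ ξ : EuclideanSpace ℝ (Fin n), ∀ α i j k l, ((ξ k * ξ l : ℝ) : ℂ) *
        realFourier (memLp_symTensor_coord hu.memLp_hess (α, i, j)).toLp ξ =
      ((ξ i * ξ j : ℝ) : ℂ) *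
        realFourier (memLp_symTensor_coord hu.memLp_hess (α, k, l)).toLp ξ := by
  have hc := memLp_symTensor_coord hu.memLp_hess
  simp only [ae_all_iff]
  intro α i j k l
  set h1 : Lp (α := EuclideanSpace ℝ (Fin n)) ℝ 2 := (hc (α, i, j)).toLp with hh1
  set h2 : Lp (α := EuclideanSpace ℝ (Fin n)) ℝ 2 := (hc (α, k, l)).toLp with hh2
  have hF := sum_mul_realFourier_eq_zero (ι := Fin 2) (p := ![k, i]) (q := ![l, j])
    (h := ![h1, -h2]) (fun φ hφ hφc => by
      simp only [Fin.sum_univ_two, Matrix.cons_val_zero, Matrix.cons_val_one]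
      have a1 : ∫ x, h1 x * partialDeriv k (partialDeriv l φ) x =
          ∫ x, (H x).1 (α, i, j) * partialDeriv k (partialDeriv l φ) x := by
        refine integral_congr_ae ?_
        filter_upwards [(hc (α, i, j)).coeFn_toLp] with x hx
        rw [hx]
      have a2 : ∫ x, (-h2) x * partialDeriv i (partialDeriv j φ) x =
          -∫ x, (H x).1 (α, k, l) * partialDeriv i (partialDeriv j φ) x := by
        rw [← integral_neg]
        refine integral_congr_ae ?_
        filter_upwards [(hc (α, k, l)).coeFn_toLp, Lp.coeFn_neg h2] with x hx hx'
        rw [hx', Pi.neg_apply, hx, neg_mul]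
      rw [a1, a2, hu.integral_hess_mul_comm α i j k l hφ hφc, add_neg_cancel])
  filter_upwards [hF, Lp.coeFn_neg (realFourier h2)] with ξ hξ hξ'
  simp only [Fin.sum_univ_two, Matrix.cons_val_zero, Matrix.cons_val_one, map_neg] at hξ
  rw [hξ', Pi.neg_apply, mul_neg, ← sub_eq_add_neg, sub_eq_zero] at hξ
  exact hξ

/-- The linear a priori estimate `ν ‖D²u‖ ≤ ‖A : D²u‖` in `L²`: by `IsW22Star.realFourier_hess`,
rank-one positivity gives it pointwise on the Fourier side. -/
theorem IsW22Star.mul_eLpNorm_hess_le {A : FourTensor N n} {ν : ℝ} (hn : 0 < n) (hν : 0 < ν)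
    (hA : ∀ (η : EuclideanSpace ℝ (Fin N)) (a : EuclideanSpace ℝ (Fin n)),
      ν * ‖η‖ ^ 2 * ‖a‖ ^ 2 ≤ A.rankOneForm η a)
    {u G} {H : EuclideanSpace ℝ (Fin n) → symTensor N n} (hu : IsW22Star u G H) :
    ENNReal.ofReal ν * eLpNorm H 2 volume ≤ eLpNorm (fun x => A.contract (H x)) 2 volume := by
  have hAH : MemLp (fun x => A.contract (H x)) 2 volume :=
    hu.memLp_hess.continuousLinearMap_comp A.contractCLM
  have hc := memLp_symTensor_coord hu.memLp_hess
  have hcurl := hu.realFourier_hess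
  let h : Fin N × Fin n × Fin n → Lp (α := EuclideanSpace ℝ (Fin n)) ℝ 2 := fun s => (hc s).toLp
  let g : Fin N → Lp (α := EuclideanSpace ℝ (Fin n)) ℝ 2 := fun α =>
    ∑ s : Fin N × Fin n × Fin n, A α s.1 s.2.1 s.2.2 • h s
  have hg : ∀ α, g α =ᵐ[volume] fun x => A.contract (H x) α := by
    intro α
    refine (coeFn_sum_smul _ _).trans ?_
    filter_upwards [ae_all_iff.2 fun s => (hc s).coeFn_toLp] with x hx
    simp only [h, hx, smul_eq_mul, Fintype.sum_prod_type]
    rfl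
  have hFg : ∀ α, realFourier (g α) =ᵐ[volume] fun ξ =>
      ∑ β, ∑ i, ∑ j, (A α β i j : ℂ) * realFourier (h (β, i, j)) ξ := by
    intro α
    have e : realFourier (g α) =
        ∑ s : Fin N × Fin n × Fin n, A α s.1 s.2.1 s.2.2 • realFourier (h s) := by
      simp only [g, map_sum, map_smul]
    rw [e]
    refine (coeFn_sum_smul _ _).trans (Filter.Eventually.of_forall fun ξ => ?_)
    simp only [Fintype.sum_prod_type, Complex.real_smul]
  have hpt : ∀ᵐ ξ : EuclideanSpace ℝ (Fin n),
      ν ^ 2 * ∑ s, ‖realFourier (h s) ξ‖ ^ 2 ≤ ∑ α, ‖realFourier (g α) ξ‖ ^ 2 := by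
    filter_upwards [hcurl, ae_ne_zero_of_pos hn, ae_all_iff.2 hFg] with ξ hξ hξ0 hξg
    have := FourTensor.sq_mul_sum_norm_sq_le hν hA hξ0
      (M := fun β i j => realFourier (h (β, i, j)) ξ)
      (m := fun β => ∑ k, realFourier (h (β, k, k)) ξ) (fun β i j => by
        have e : ∀ k, _ := fun k => hξ β i j k k
        rw [Finset.mul_sum, ← Finset.sum_congr rfl fun k _ => e k, ← Finset.sum_mul,
          EuclideanSpace.real_norm_sq_eq]
        simp [sq, h])
    simpa only [hξg, Fintype.sum_prod_type] using this
  have hint : ∀ f : Lp (α := EuclideanSpace ℝ (Fin n)) ℝ 2,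
      Integrable (fun ξ => ‖realFourier f ξ‖ ^ 2) volume := fun f =>
    (Lp.memLp (realFourier f)).integrable_norm_pow (p := 2) two_ne_zero
  have hsum := integral_mono_ae
    ((integrable_finsetSum _ fun s _ => hint (h s)).const_mul (ν ^ 2))
    (integrable_finsetSum _ fun α _ => hint (g α)) hpt
  rw [integral_const_mul, integral_finsetSum _ fun α _ => hint (g α),
    integral_finsetSum _ fun s _ => hint (h s)] at hsum
  have hl : ∫ x, ‖H x‖ ^ 2 = ∑ s, ∫ ξ, ‖realFourier (h s) ξ‖ ^ 2 := by
    simp only [norm_sq_symTensor]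
    rw [integral_finsetSum _ fun s _ => (hc s).integrable_sq]
    refine Finset.sum_congr rfl fun s _ => ?_
    rw [integral_sq_realFourier]
    refine integral_congr_ae ?_
    filter_upwards [(hc s).coeFn_toLp] with x hx
    rw [hx]
  have hr : ∫ x, ‖A.contract (H x)‖ ^ 2 = ∑ α, ∫ ξ, ‖realFourier (g α) ξ‖ ^ 2 := by
    simp only [EuclideanSpace.real_norm_sq_eq]
    rw [integral_finsetSum _ fun α _ => (hAH.eval_piLp α).integrable_sq]
    refine Finset.sum_congr rfl fun α _ => ?_
    rw [integral_sq_realFourier]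
    refine integral_congr_ae ?_
    filter_upwards [hg α] with x hx
    rw [hx]
  rw [← hl, ← hr, integral_norm_sq_eq hu.memLp_hess, integral_norm_sq_eq hAH, ← mul_pow] at hsum
  have h5 := le_of_abs_le (abs_le_of_sq_le_sq hsum ENNReal.toReal_nonneg)
  rw [← ENNReal.ofReal_toReal hu.memLp_hess.2.ne, ← ENNReal.ofReal_toReal hAH.2.ne,
    ← ENNReal.ofReal_mul hν.le]
  exact ENNReal.ofReal_le_ofReal h5

end Components

/-! ### Vector-valued test functions -/

section TestFunctions

variable (N n : ℕ)

/-- The smooth compactly supported maps `ℝⁿ → ℝ^N`. -/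
def testSubmodule : Submodule ℝ (EuclideanSpace ℝ (Fin n) → EuclideanSpace ℝ (Fin N)) where
  carrier := {u | ContDiff ℝ ∞ u ∧ HasCompactSupport u}
  add_mem' hu hv := ⟨hu.1.add hv.1, hu.2.add hv.2⟩
  zero_mem' := ⟨contDiff_const, HasCompactSupport.zero⟩
  smul_mem' c _ hu := ⟨hu.1.const_smul c, hu.2.smul_left (f := fun _ => c)⟩

/-- The type of smooth compactly supported maps `ℝⁿ → ℝ^N`. -/
abbrev VectorTest : Type := testSubmodule N n

variable {N n}

namespace VectorTest

theorem contDiff (u : VectorTest N n) : ContDiff ℝ ∞ u.1 := u.2.1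

theorem hasCompactSupport (u : VectorTest N n) : HasCompactSupport u.1 := u.2.2

theorem contDiff_coord (u : VectorTest N n) (α : Fin N) : ContDiff ℝ ∞ fun x => u.1 x α :=
  (EuclideanSpace.proj (𝕜 := ℝ) α).contDiff.comp u.contDiff

theorem hasCompactSupport_coord (u : VectorTest N n) (α : Fin N) :
    HasCompactSupport fun x => u.1 x α :=
  u.hasCompactSupport.comp_left (g := fun y : EuclideanSpace ℝ (Fin N) => y α) rfl

/-- The gradient `(∂_i u_α)`, as a linear map of `u`. -/
def grad : VectorTest N n →ₗ[ℝ] EuclideanSpace ℝ (Fin n) → EuclideanSpace ℝ (Fin N × Fin n) where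
  toFun u x := WithLp.toLp 2 fun s => partialDeriv s.2 (fun y => u.1 y s.1) x
  map_add' u v := by
    funext x
    ext s
    exact congrFun (partialDeriv_add (u.contDiff_coord s.1) (v.contDiff_coord s.1) s.2) x
  map_smul' c u := by
    funext x
    ext s
    exact congrFun (partialDeriv_const_smul c (u.contDiff_coord s.1) s.2) x

/-- The hessian `(∂_j ∂_i u_α)`, as a linear map of `u`. -/
def hess : VectorTest N n →ₗ[ℝ] EuclideanSpace ℝ (Fin n) → symTensor N n where
  toFun u x := ⟨WithLp.toLp 2 fun s =>
      partialDeriv s.2.2 (partialDeriv s.2.1 fun y => u.1 y s.1) x,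
    fun α i j => congrFun (partialDeriv_comm (u.contDiff_coord α) j i) x⟩
  map_add' u v := by
    funext x
    ext s
    have h := partialDeriv_add (u.contDiff_coord s.1) (v.contDiff_coord s.1) s.2.1
    have h' := partialDeriv_add ((u.contDiff_coord s.1).partialDeriv s.2.1)
      ((v.contDiff_coord s.1).partialDeriv s.2.1) s.2.2
    rw [← h] at h'
    exact congrFun h' x
  map_smul' c u := by
    funext x
    ext s
    have h := partialDeriv_const_smul c (u.contDiff_coord s.1) s.2.1
    have h' := partialDeriv_const_smul c ((u.contDiff_coord s.1).partialDeriv s.2.1) s.2.2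
    rw [← h] at h'
    exact congrFun h' x

theorem hess_apply (u : VectorTest N n) (x : EuclideanSpace ℝ (Fin n))
    (s : Fin N × Fin n × Fin n) :
    (hess u x).1 s = partialDeriv s.2.2 (partialDeriv s.2.1 fun y => u.1 y s.1) x := rfl

theorem contDiff_grad (u : VectorTest N n) : ContDiff ℝ ∞ (grad u) := by
  rw [contDiff_euclidean]
  exact fun s => (u.contDiff_coord s.1).partialDeriv s.2

theorem hasCompactSupport_grad (u : VectorTest N n) : HasCompactSupport (grad u) := by
  refine HasCompactSupport.intro u.hasCompactSupport fun x hx => ?_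
  ext s
  have h : x ∉ tsupport fun y => u.1 y s.1 := fun h => hx (closure_mono (fun y hy => by
    contrapose! hy
    simp_all) h)
  exact congrArg (fun L : EuclideanSpace ℝ (Fin n) →L[ℝ] ℝ => L (EuclideanSpace.single s.2 1))
    (fderiv_of_notMem_tsupport ℝ h)

theorem continuous_hess (u : VectorTest N n) : Continuous (hess u) := by
  refine Continuous.subtype_mk ((PiLp.continuous_toLp 2 _).comp (continuous_pi fun s => ?_)) _
  exact (((u.contDiff_coord s.1).partialDeriv s.2.1).partialDeriv s.2.2).continuous

theorem memLp (u : VectorTest N n) (p : ℝ≥0∞) : MemLp u.1 p volume :=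
  u.contDiff.continuous.memLp_of_hasCompactSupport u.hasCompactSupport

theorem memLp_grad (u : VectorTest N n) (p : ℝ≥0∞) : MemLp (grad u) p volume :=
  u.contDiff_grad.continuous.memLp_of_hasCompactSupport u.hasCompactSupport_grad

theorem memLp_hess (u : VectorTest N n) (p : ℝ≥0∞) : MemLp (hess u) p volume := by
  have h : MemLp (fun x => (hess u x).1) p volume := by
    rw [memLp_piLp_iff]
    intro s
    exact (((u.contDiff_coord s.1).partialDeriv s.2.1).partialDeriv
      s.2.2).continuous.memLp_of_hasCompactSupport
      (((u.hasCompactSupport_coord s.1).partialDeriv s.2.1).partialDeriv s.2.2)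
  exact (memLp_congr_norm u.continuous_hess.aestronglyMeasurable h.1
    (Filter.Eventually.of_forall fun x => rfl)).2 h

theorem isWeakPartial_of_contDiff {f : EuclideanSpace ℝ (Fin n) → ℝ} (hf : ContDiff ℝ ∞ f)
    (i : Fin n) : IsWeakPartial i f (partialDeriv i f) :=
  ⟨hf.continuous.locallyIntegrable, (hf.partialDeriv i).continuous.locallyIntegrable,
    fun _ hφ hc => integral_mul_partialDeriv hf hφ hc i⟩

theorem isW22Star (u : VectorTest N n) : IsW22Star u.1 (grad u) (hess u) where
  memLp_fun := u.memLp _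
  memLp_grad := u.memLp_grad _
  memLp_hess := u.memLp_hess _
  weak_grad α i := isWeakPartial_of_contDiff (u.contDiff_coord α) i
  weak_hess α i j := isWeakPartial_of_contDiff ((u.contDiff_coord α).partialDeriv i) j

end VectorTest

end TestFunctions

/-! ### The Sobolev inequality for test functions -/

section Sobolev

variable {n : ℕ}

theorem norm_fderiv_le_of_partialDeriv {V : Type*} [NormedAddCommGroup V] [NormedSpace ℝ V]
    (g : EuclideanSpace ℝ (Fin n) → V) (x : EuclideanSpace ℝ (Fin n)) {K : ℝ} (hK0 : 0 ≤ K)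
    (hK : ∀ j, ‖partialDeriv j g x‖ ≤ K) : ‖fderiv ℝ g x‖ ≤ n * K := by
  refine ContinuousLinearMap.opNorm_le_bound _ (by positivity) fun v => ?_
  have hv : v = ∑ j, v j • EuclideanSpace.single j (1 : ℝ) := by
    ext i
    simp [Finset.sum_apply, Pi.single_apply]
  have h1 : fderiv ℝ g x v = ∑ j, v j • partialDeriv j g x := by
    conv_lhs => rw [hv]
    simp only [map_sum, map_smul, partialDeriv]
  calc ‖fderiv ℝ g x v‖ ≤ ∑ j, ‖v j • partialDeriv j g x‖ := by
        rw [h1]; exact norm_sum_le _ _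
    _ ≤ ∑ _j : Fin n, ‖v‖ * K := by
        refine Finset.sum_le_sum fun j _ => ?_
        rw [norm_smul]
        exact mul_le_mul (PiLp.norm_apply_le v j) (hK j) (norm_nonneg _) (norm_nonneg _)
    _ = n * K * ‖v‖ := by
        simp only [Finset.sum_const, Finset.card_univ, Fintype.card_fin, nsmul_eq_mul]
        ring

theorem exists_sobolev_const {V W : Type*} [NormedAddCommGroup V] [NormedSpace ℝ V]
    [FiniteDimensional ℝ V] [NormedAddCommGroup W] (hn : 0 < n) {p p' : NNReal} (hp : 1 ≤ p)
    (hp' : (p' : ℝ)⁻¹ = (p : ℝ)⁻¹ - (n : ℝ)⁻¹) :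
    ∃ C : NNReal, ∀ (g : EuclideanSpace ℝ (Fin n) → V) (K : EuclideanSpace ℝ (Fin n) → W),
      ContDiff ℝ ∞ g → HasCompactSupport g → (∀ x j, ‖partialDeriv j g x‖ ≤ ‖K x‖) →
      eLpNorm g p' volume ≤ C * eLpNorm K p volume := by
  refine ⟨SNormLESNormFDerivOfEqConst V
    (volume : Measure (EuclideanSpace ℝ (Fin n))) p * n, fun g K hg hgc hK => ?_⟩
  have h1 := eLpNorm_le_eLpNorm_fderiv_of_eq (volume : Measure (EuclideanSpace ℝ (Fin n)))
    (hg.of_le (by simp)) hgc hp (by simpa using hn) (by simpa using hp')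
  refine h1.trans ?_
  rw [ENNReal.coe_mul, mul_assoc]
  gcongr
  have h2 := eLpNorm_le_nnreal_smul_eLpNorm_of_ae_le_mul (f := fderiv ℝ g) (g := K)
    (c := (n : NNReal)) (μ := volume) (Filter.Eventually.of_forall fun x =>
      norm_fderiv_le_of_partialDeriv g x (norm_nonneg _) (hK x)) p
  exact h2

theorem one_le_twoStar (hn : 5 ≤ n) : 1 ≤ twoStar n := by
  have h : (5 : ℝ) ≤ n := by exact_mod_cast hn
  rw [twoStar, ENNReal.one_le_ofReal, le_div_iff₀ (by linarith)]
  linarith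

theorem one_le_twoStarStar (hn : 5 ≤ n) : 1 ≤ twoStarStar n := by
  have h : (5 : ℝ) ≤ n := by exact_mod_cast hn
  rw [twoStarStar, ENNReal.one_le_ofReal, le_div_iff₀ (by linarith)]
  linarith

variable {N : ℕ}

/-- The Sobolev inequality with exponents `2 → 2^*` for the gradient and `2^* → 2^{**}` for the
function. -/
theorem VectorTest.exists_eLpNorm_le (N : ℕ) (hn : 5 ≤ n) :
    ∃ C₁ C₂ : NNReal, ∀ u : VectorTest N n,
      eLpNorm (grad u) (twoStar n) volume ≤ C₁ * eLpNorm (hess u) 2 volume ∧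
      eLpNorm u.1 (twoStarStar n) volume ≤ C₂ * eLpNorm (hess u) 2 volume := by
  have h : (5 : ℝ) ≤ n := by exact_mod_cast hn
  have h2 : (0 : ℝ) < n - 2 := by linarith
  have h4 : (0 : ℝ) < n - 4 := by linarith
  have e1 : ((Real.toNNReal (2 * (n : ℝ) / ((n : ℝ) - 2)) : NNReal) : ℝ) =
      2 * (n : ℝ) / ((n : ℝ) - 2) := Real.coe_toNNReal _ (by positivity)
  have e2 : ((Real.toNNReal (2 * (n : ℝ) / ((n : ℝ) - 4)) : NNReal) : ℝ) =
      2 * (n : ℝ) / ((n : ℝ) - 4) := Real.coe_toNNReal _ (by positivity)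
  obtain ⟨C₁, hC₁⟩ := exists_sobolev_const (n := n) (V := EuclideanSpace ℝ (Fin N × Fin n))
    (W := symTensor N n) (by omega) (p := 2)
    (p' := Real.toNNReal (2 * (n : ℝ) / ((n : ℝ) - 2))) one_le_two (by
      rw [e1]
      push_cast
      field_simp)
  obtain ⟨C₂, hC₂⟩ := exists_sobolev_const (n := n) (V := EuclideanSpace ℝ (Fin N))
    (W := EuclideanSpace ℝ (Fin N × Fin n)) (by omega)
    (p := Real.toNNReal (2 * (n : ℝ) / ((n : ℝ) - 2)))
    (p' := Real.toNNReal (2 * (n : ℝ) / ((n : ℝ) - 4)))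
    (by
      rw [← NNReal.coe_le_coe, e1, NNReal.coe_one, le_div_iff₀ h2]
      linarith) (by
      rw [e1, e2]
      field_simp
      ring)
  refine ⟨C₁, C₂ * C₁, fun u => ?_⟩
  have b1 := hC₁ (grad u) (hess u) u.contDiff_grad u.hasCompactSupport_grad (fun x j => by
    rw [EuclideanSpace.norm_eq]
    change _ ≤ ‖(hess u x).1‖
    rw [EuclideanSpace.norm_eq]
    refine Real.sqrt_le_sqrt ?_
    have hcoord : ∀ s : Fin N × Fin n, partialDeriv j (grad u) x s =
        (hess u x).1 (s.1, s.2, j) := fun s =>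
      (congrFun (partialDeriv_clm_comp (EuclideanSpace.proj (𝕜 := ℝ) s) u.contDiff_grad j)
        x).symm
    simp only [hcoord, Fintype.sum_prod_type]
    refine Finset.sum_le_sum fun α _ => Finset.sum_le_sum fun i _ => ?_
    exact Finset.single_le_sum (f := fun j => ‖(hess u x).1 (α, i, j)‖ ^ 2)
      (fun _ _ => by positivity) (Finset.mem_univ j))
  have b2 := hC₂ u.1 (grad u) u.contDiff u.hasCompactSupport (fun x j => by
    rw [EuclideanSpace.norm_eq, EuclideanSpace.norm_eq]
    refine Real.sqrt_le_sqrt ?_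
    have hcoord : ∀ α : Fin N, partialDeriv j u.1 x α = grad u x (α, j) := fun α =>
      (congrFun (partialDeriv_clm_comp (EuclideanSpace.proj (𝕜 := ℝ) α) u.contDiff j) x).symm
    simp only [hcoord, Fintype.sum_prod_type]
    refine Finset.sum_le_sum fun α _ => ?_
    exact Finset.single_le_sum (f := fun j => ‖grad u x (α, j)‖ ^ 2)
      (fun _ _ => by positivity) (Finset.mem_univ j))
  refine ⟨b1, b2.trans ?_⟩
  rw [ENNReal.coe_mul, mul_assoc]
  exact mul_le_mul_right b1 _

end Sobolev

/-! ### Density of the range of the linear operator -/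

section Density

variable {N n : ℕ}

/-- A linear map into functions with values in `ℒ^p`, as a linear map into `L^p`. -/
def toLpLinear {X V α : Type*} [AddCommGroup X] [Module ℝ X] [MeasurableSpace α] {μ : Measure α}
    [NormedAddCommGroup V] [NormedSpace ℝ V] (p : ℝ≥0∞) (T : X →ₗ[ℝ] α → V)
    (hT : ∀ u, MemLp (T u) p μ) : X →ₗ[ℝ] Lp V p μ where
  toFun u := (hT u).toLp
  map_add' u v := by
    rw [← MemLp.toLp_add]
    exact MemLp.toLp_congr _ _ (Filter.EventuallyEq.of_eq (map_add T u v))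
  map_smul' c u := by
    rw [RingHom.id_apply, ← MemLp.toLp_const_smul]
    exact MemLp.toLp_congr _ _ (Filter.EventuallyEq.of_eq (map_smul T c u))

theorem memLp_contract {A : FourTensor N n} {H : EuclideanSpace ℝ (Fin n) → symTensor N n}
    {p : ℝ≥0∞} (hH : MemLp H p volume) : MemLp (fun x => A.contract (H x)) p volume :=
  hH.continuousLinearMap_comp A.contractCLM

/-- The linear operator `u ↦ A : D²u` from test functions to `L²`. -/
def FourTensor.testOperator (A : FourTensor N n) :
    VectorTest N n →ₗ[ℝ] Lp (α := EuclideanSpace ℝ (Fin n)) (EuclideanSpace ℝ (Fin N)) 2 :=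
  toLpLinear 2 ((A.contractCLM.toLinearMap.compLeft (EuclideanSpace ℝ (Fin n))).comp
    VectorTest.hess) fun u => memLp_contract (u.memLp_hess 2)

theorem FourTensor.coeFn_testOperator (A : FourTensor N n) (u : VectorTest N n) :
    A.testOperator u =ᵐ[volume] fun x => A.contract (VectorTest.hess u x) :=
  MemLp.coeFn_toLp (memLp_contract (u.memLp_hess 2))

/-- The scalar test function `φ` placed in the `β`-th component. -/
def VectorTest.single (β : Fin N) {φ : EuclideanSpace ℝ (Fin n) → ℝ} (hφ : ContDiff ℝ ∞ φ)
    (hc : HasCompactSupport φ) : VectorTest N n :=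
  ⟨fun x => φ x • EuclideanSpace.single β 1, hφ.smul contDiff_const, hc.smul_right⟩

theorem VectorTest.contract_hess_single (A : FourTensor N n) (β : Fin N)
    {φ : EuclideanSpace ℝ (Fin n) → ℝ} (hφ : ContDiff ℝ ∞ φ) (hc : HasCompactSupport φ)
    (x : EuclideanSpace ℝ (Fin n)) (α : Fin N) :
    A.contract (hess (single β hφ hc) x) α =
      ∑ i, ∑ j, A α β i j * partialDeriv j (partialDeriv i φ) x := by
  have h : ∀ s, (hess (single β hφ hc) x).1 s =
      (EuclideanSpace.single β (1 : ℝ) : EuclideanSpace ℝ (Fin N)) s.1 *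
        partialDeriv s.2.2 (partialDeriv s.2.1 φ) x := by
    intro s
    have e : (fun y => (single (N := N) β hφ hc).1 y s.1) = fun y =>
        (EuclideanSpace.single β (1 : ℝ) : EuclideanSpace ℝ (Fin N)) s.1 • φ y := by
      funext y
      simp only [single, PiLp.smul_apply, smul_eq_mul, mul_comm]
    rw [hess_apply, e, partialDeriv_const_smul _ hφ,
      partialDeriv_const_smul _ (hφ.partialDeriv s.2.1)]
    simp only [smul_eq_mul]
  simp only [FourTensor.contract, h]
  rw [Finset.sum_eq_single β]
  · simp
  · intro b _ hb
    simp [hb]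
  · simp

/-- The matrix `(∑ A_{αβij} ξ_i ξ_j)_{αβ}` has trivial left kernel for `ξ ≠ 0`. -/
theorem FourTensor.eq_zero_of_forall_sum_eq_zero {A : FourTensor N n} {ν : ℝ} (hν : 0 < ν)
    (hA : ∀ (η : EuclideanSpace ℝ (Fin N)) (a : EuclideanSpace ℝ (Fin n)),
      ν * ‖η‖ ^ 2 * ‖a‖ ^ 2 ≤ A.rankOneForm η a)
    {ξ : EuclideanSpace ℝ (Fin n)} (hξ : ξ ≠ 0) {η : EuclideanSpace ℝ (Fin N)}
    (h : ∀ β, ∑ α, ∑ i, ∑ j, A α β i j * (ξ j * ξ i) * η α = 0) : η = 0 := by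
  have h1 : A.rankOneForm η ξ = ∑ β, η β * ∑ α, ∑ i, ∑ j, A α β i j * (ξ j * ξ i) * η α := by
    rw [rankOneForm, Finset.sum_comm]
    refine Finset.sum_congr rfl fun β _ => ?_
    simp only [Finset.mul_sum]
    refine Finset.sum_congr rfl fun α _ => Finset.sum_congr rfl fun i _ =>
      Finset.sum_congr rfl fun j _ => ?_
    ring
  have h2 := hA η ξ
  simp only [h1, h, mul_zero, Finset.sum_const_zero] at h2
  by_contra hη
  have : 0 < ν * ‖η‖ ^ 2 * ‖ξ‖ ^ 2 := by
    have := norm_pos_iff.2 hη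
    have := norm_pos_iff.2 hξ
    positivity
  linarith

/-- `A : D²` has dense range in `L²`: for `g` orthogonal to the range, the Fourier transform of the
adjoint equation reads `A(ξ)ᵀ ĝ(ξ) = 0`, where `A(ξ) = ∑ A_{αβij} ξ_i ξ_j` is positive definite. -/
theorem FourTensor.denseRange_testOperator {A : FourTensor N n} {ν : ℝ} (hn : 0 < n) (hν : 0 < ν)
    (hA : ∀ (η : EuclideanSpace ℝ (Fin N)) (a : EuclideanSpace ℝ (Fin n)),
      ν * ‖η‖ ^ 2 * ‖a‖ ^ 2 ≤ A.rankOneForm η a) : DenseRange A.testOperator := by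
  have hrange : (LinearMap.range A.testOperator).topologicalClosure = ⊤ := by
    rw [Submodule.topologicalClosure_eq_top_iff, Submodule.eq_bot_iff]
    intro g hg
    have hgm : ∀ α, MemLp (fun x => g x α) 2 volume := (Lp.memLp g).eval_piLp
    let gc : Fin N → Lp (α := EuclideanSpace ℝ (Fin n)) ℝ 2 := fun α => (hgm α).toLp
    have hgc : ∀ᵐ x, ∀ α, gc α x = g x α := ae_all_iff.2 fun α => (hgm α).coeFn_toLp
    have hF : ∀ β, ∀ᵐ ξ : EuclideanSpace ℝ (Fin n), ∑ s : Fin N × Fin n × Fin n,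
        ((ξ s.2.2 * ξ s.2.1 : ℝ) : ℂ) * realFourier (A s.1 β s.2.1 s.2.2 • gc s.1) ξ = 0 := by
      intro β
      refine sum_mul_realFourier_eq_zero (p := fun s : Fin N × Fin n × Fin n => s.2.2)
        (q := fun s => s.2.1) (h := fun s => A s.1 β s.2.1 s.2.2 • gc s.1) fun φ hφ hc => ?_
      have h1 := hg (A.testOperator (VectorTest.single β hφ hc)) ⟨_, rfl⟩
      rw [L2.inner_def] at h1
      rw [← integral_finsetSum, ← h1]
      · refine integral_congr_ae ?_
        filter_upwards [hgc, A.coeFn_testOperator (VectorTest.single β hφ hc),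
          ae_all_iff.2 fun s : Fin N × Fin n × Fin n =>
            Lp.coeFn_smul (A s.1 β s.2.1 s.2.2) (gc s.1)] with x hx1 hx2 hx3
        simp only [hx3, hx2, PiLp.inner_apply, VectorTest.contract_hess_single, Pi.smul_apply,
          hx1, Fintype.sum_prod_type, RCLike.inner_apply, conj_trivial, smul_eq_mul,
          Finset.mul_sum]
        refine Finset.sum_congr rfl fun α _ => Finset.sum_congr rfl fun i _ =>
          Finset.sum_congr rfl fun j _ => ?_
        ring
      · intro s _
        exact (Lp.memLp _).integrable_mul
          (((hφ.partialDeriv s.2.1).partialDeriv s.2.2).continuous.memLp_of_hasCompactSupport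
            ((hc.partialDeriv s.2.1).partialDeriv s.2.2) (p := 2))
    have hzero : ∀ α, gc α = 0 := by
      have hpt : ∀ᵐ ξ : EuclideanSpace ℝ (Fin n), ∀ α, realFourier (gc α) ξ = 0 := by
        have hsm : ∀ᵐ ξ : EuclideanSpace ℝ (Fin n), ∀ (β : Fin N) (s : Fin N × Fin n × Fin n),
            realFourier (A s.1 β s.2.1 s.2.2 • gc s.1) ξ =
              (A s.1 β s.2.1 s.2.2 : ℂ) * realFourier (gc s.1) ξ := by
          simp only [ae_all_iff, map_smul]
          intro β s
          filter_upwards [Lp.coeFn_smul (A s.1 β s.2.1 s.2.2) (realFourier (gc s.1))] with ξ hξ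
          rw [hξ, Pi.smul_apply, Complex.real_smul]
        filter_upwards [ae_all_iff.2 hF, hsm, ae_ne_zero_of_pos hn] with ξ h1 h2 h3
        simp only [h2, Fintype.sum_prod_type] at h1
        have hre := eq_zero_of_forall_sum_eq_zero hν hA h3
          (η := WithLp.toLp 2 fun α => (realFourier (gc α) ξ).re) (fun β => by
            have := congrArg Complex.re (h1 β)
            simp only [Complex.re_sum, Complex.re_ofReal_mul, Complex.zero_re] at this
            rw [← this]
            refine Finset.sum_congr rfl fun α _ => Finset.sum_congr rfl fun i _ =>
              Finset.sum_congr rfl fun j _ => ?_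
            ring)
        have him := eq_zero_of_forall_sum_eq_zero hν hA h3
          (η := WithLp.toLp 2 fun α => (realFourier (gc α) ξ).im) (fun β => by
            have := congrArg Complex.im (h1 β)
            simp only [Complex.im_sum, Complex.im_ofReal_mul, Complex.zero_im] at this
            rw [← this]
            refine Finset.sum_congr rfl fun α _ => Finset.sum_congr rfl fun i _ =>
              Finset.sum_congr rfl fun j _ => ?_
            ring)
        intro α
        exact Complex.ext (congrArg (fun v : EuclideanSpace ℝ (Fin N) => v α) hre)
          (congrArg (fun v : EuclideanSpace ℝ (Fin N) => v α) him)
      intro α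
      rw [← norm_eq_zero, ← norm_realFourier, norm_eq_zero, Lp.eq_zero_iff_ae_eq_zero]
      filter_upwards [hpt] with ξ hξ using hξ α
    rw [Lp.eq_zero_iff_ae_eq_zero]
    filter_upwards [hgc, ae_all_iff.2 fun α => (Lp.eq_zero_iff_ae_eq_zero.1 (hzero α))]
      with x hx hx'
    ext α
    rw [← hx α, hx' α]
    rfl
  intro f
  have := (Submodule.mem_top : f ∈ (⊤ : Submodule ℝ _))
  rw [← hrange] at this
  exact this

end Density

/-! ### Solvability of the linear system -/

section Linear

variable {N n : ℕ}

/-- If `‖T x‖ ≤ C ‖R x‖` in `L^p`, then `T x_k` converges along with `R x_k`. -/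
theorem exists_tendsto_toLpLinear {X V Z α : Type*} [AddCommGroup X] [Module ℝ X]
    [MeasurableSpace α] {μ : Measure α} [NormedAddCommGroup V] [NormedSpace ℝ V] [CompleteSpace V]
    [NormedAddCommGroup Z] [NormedSpace ℝ Z] {p : ℝ≥0∞} [Fact (1 ≤ p)] {T : X →ₗ[ℝ] α → V}
    (hT : ∀ u, MemLp (T u) p μ) {R : X →ₗ[ℝ] Z} {C : ℝ}
    (h : ∀ x, ‖toLpLinear p T hT x‖ ≤ C * ‖R x‖)
    {x : ℕ → X} {f : Z} (hx : Filter.Tendsto (fun k => R (x k)) Filter.atTop (nhds f)) :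
    ∃ y, Filter.Tendsto (fun k => toLpLinear p T hT (x k)) Filter.atTop (nhds y) ∧
      ‖y‖ ≤ C * ‖f‖ := by
  have hC : CauchySeq fun k => toLpLinear p T hT (x k) := by
    have hR : Filter.Tendsto (fun p : ℕ × ℕ => C * dist (R (x p.1)) (R (x p.2))) Filter.atTop
        (nhds 0) := by
      simpa using (cauchySeq_iff_tendsto_dist_atTop_0.1 hx.cauchySeq).const_mul C
    refine cauchySeq_iff_tendsto_dist_atTop_0.2
      (squeeze_zero (fun _ => dist_nonneg) (fun p => ?_) hR)
    rw [dist_eq_norm, dist_eq_norm, ← map_sub, ← map_sub]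
    exact h _
  obtain ⟨y, hy⟩ := cauchySeq_tendsto_of_complete hC
  exact ⟨y, hy, le_of_tendsto_of_tendsto hy.norm (hx.norm.const_mul C)
    (Filter.Eventually.of_forall fun k => h _)⟩

theorem tendsto_integral_clm_mul {V : Type*} [NormedAddCommGroup V] [NormedSpace ℝ V]
    {p : ℝ≥0∞} [Fact (1 ≤ p)] (L : V →L[ℝ] ℝ)
    {f : ℕ → Lp (α := EuclideanSpace ℝ (Fin n)) V p volume} {f₀ : Lp V p volume}
    (hf : Filter.Tendsto f Filter.atTop (nhds f₀)) {ψ : EuclideanSpace ℝ (Fin n) → ℝ}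
    (hψ : Continuous ψ) (hc : HasCompactSupport ψ) :
    Filter.Tendsto (fun k => ∫ x, L (f k x) * ψ x) Filter.atTop (nhds (∫ x, L (f₀ x) * ψ x)) := by
  let B : V →L[ℝ] ℝ →L[ℝ] ℝ := (ContinuousLinearMap.mul ℝ ℝ).comp L
  have hq : Fact (1 ≤ ENNReal.conjExponent p) := ⟨by simp [ENNReal.conjExponent]⟩
  have hm : MemLp ψ (ENNReal.conjExponent p) volume := hψ.memLp_of_hasCompactSupport hc
  have key : ∀ g : Lp (α := EuclideanSpace ℝ (Fin n)) V p volume,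
      B.lpPairing volume p (ENNReal.conjExponent p) g hm.toLp = ∫ x, L (g x) * ψ x := by
    intro g
    rw [ContinuousLinearMap.lpPairing_eq_integral]
    refine integral_congr_ae ?_
    filter_upwards [hm.coeFn_toLp] with x hx
    rw [hx]
    rfl
  simp only [← key]
  exact (((B.lpPairing volume p (ENNReal.conjExponent p)).flip hm.toLp).continuous.tendsto
    f₀).comp hf

theorem isWeakPartial_of_tendsto {V W : Type*} [NormedAddCommGroup V] [NormedSpace ℝ V]
    [NormedAddCommGroup W] [NormedSpace ℝ W] {p q : ℝ≥0∞} [Fact (1 ≤ p)] [Fact (1 ≤ q)]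
    (L : V →L[ℝ] ℝ) (K : W →L[ℝ] ℝ) {i : Fin n}
    {f : ℕ → Lp (α := EuclideanSpace ℝ (Fin n)) V p volume} {f₀ : Lp V p volume}
    {g : ℕ → Lp (α := EuclideanSpace ℝ (Fin n)) W q volume} {g₀ : Lp W q volume}
    (hf : Filter.Tendsto f Filter.atTop (nhds f₀)) (hg : Filter.Tendsto g Filter.atTop (nhds g₀))
    (h : ∀ k, ∀ φ : EuclideanSpace ℝ (Fin n) → ℝ, ContDiff ℝ ∞ φ → HasCompactSupport φ →
      ∫ x, L (f k x) * partialDeriv i φ x = - ∫ x, K (g k x) * φ x) :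
    IsWeakPartial i (fun x => L (f₀ x)) (fun x => K (g₀ x)) := by
  refine ⟨((Lp.memLp f₀).continuousLinearMap_comp L).locallyIntegrable Fact.out,
    ((Lp.memLp g₀).continuousLinearMap_comp K).locallyIntegrable Fact.out, fun φ hφ hc => ?_⟩
  refine tendsto_nhds_unique (tendsto_integral_clm_mul L hf (hφ.partialDeriv i).continuous
    (hc.partialDeriv i)) ?_
  exact (tendsto_integral_clm_mul K hg hφ.continuous hc).neg.congr fun k => (h k φ hφ hc).symm

theorem norm_toLp_le_of_eLpNorm_le {α V W : Type*} [MeasurableSpace α] {μ : Measure α}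
    [NormedAddCommGroup V] [NormedAddCommGroup W] {p q : ℝ≥0∞} {f : α → V} {g : α → W}
    (hf : MemLp f p μ) (hg : MemLp g q μ) {C : NNReal}
    (h : eLpNorm f p μ ≤ C * eLpNorm g q μ) : ‖hf.toLp‖ ≤ C * ‖hg.toLp‖ := by
  rw [Lp.norm_toLp, Lp.norm_toLp]
  have := ENNReal.toReal_mono (ENNReal.mul_ne_top ENNReal.coe_ne_top hg.2.ne) h
  rwa [ENNReal.toReal_mul, ENNReal.coe_toReal] at this

theorem eLpNorm_le_of_norm_le {α V W : Type*} [MeasurableSpace α] {μ : Measure α}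
    [NormedAddCommGroup V] [NormedAddCommGroup W] {p q : ℝ≥0∞} {f : Lp V p μ} {g : Lp W q μ}
    {C : NNReal} (h : ‖f‖ ≤ C * ‖g‖) : eLpNorm f p μ ≤ C * eLpNorm g q μ := by
  rw [Lp.norm_def, Lp.norm_def, ← ENNReal.coe_toReal, ← ENNReal.toReal_mul] at h
  exact (ENNReal.toReal_le_toReal (Lp.memLp f).2.ne
    (ENNReal.mul_ne_top ENNReal.coe_ne_top (Lp.memLp g).2.ne)).1 h

namespace VectorTest

/-- A test function as an element of `L^p`. -/
def funLp (p : ℝ≥0∞) : VectorTest N n →ₗ[ℝ]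
    Lp (α := EuclideanSpace ℝ (Fin n)) (EuclideanSpace ℝ (Fin N)) p :=
  toLpLinear p (testSubmodule N n).subtype fun u => u.memLp p

/-- The gradient of a test function as an element of `L^p`. -/
def gradLp (p : ℝ≥0∞) : VectorTest N n →ₗ[ℝ]
    Lp (α := EuclideanSpace ℝ (Fin n)) (EuclideanSpace ℝ (Fin N × Fin n)) p :=
  toLpLinear p grad fun u => u.memLp_grad p

/-- The hessian of a test function as an element of `L^p`. -/
def hessLp (p : ℝ≥0∞) : VectorTest N n →ₗ[ℝ]
    Lp (α := EuclideanSpace ℝ (Fin n)) (symTensor N n) p :=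
  toLpLinear p hess fun u => u.memLp_hess p

theorem coeFn_funLp (p : ℝ≥0∞) (u : VectorTest N n) : funLp p u =ᵐ[volume] u.1 :=
  (u.memLp p).coeFn_toLp

theorem coeFn_gradLp (p : ℝ≥0∞) (u : VectorTest N n) : gradLp p u =ᵐ[volume] grad u :=
  (u.memLp_grad p).coeFn_toLp

theorem coeFn_hessLp (p : ℝ≥0∞) (u : VectorTest N n) : hessLp p u =ᵐ[volume] hess u :=
  (u.memLp_hess p).coeFn_toLp

/-- The `L²` estimate for the hessian combined with the Sobolev inequality. -/
theorem exists_norm_le {A : FourTensor N n} {ν : ℝ} (hn : 5 ≤ n) (hν : 0 < ν)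
    (hA : ∀ (η : EuclideanSpace ℝ (Fin N)) (a : EuclideanSpace ℝ (Fin n)),
      ν * ‖η‖ ^ 2 * ‖a‖ ^ 2 ≤ A.rankOneForm η a) :
    ∃ C₀ C₁ C₂ : NNReal, ∀ u : VectorTest N n,
      ‖funLp (twoStarStar n) u‖ ≤ C₀ * ‖A.testOperator u‖ ∧
      ‖gradLp (twoStar n) u‖ ≤ C₁ * ‖A.testOperator u‖ ∧
      ‖hessLp 2 u‖ ≤ C₂ * ‖A.testOperator u‖ := by
  obtain ⟨C₁, C₂, hC⟩ := VectorTest.exists_eLpNorm_le N hn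
  let c : NNReal := ⟨ν⁻¹, by positivity⟩
  have hhess : ∀ u : VectorTest N n, eLpNorm (hess u) 2 volume ≤
      c * eLpNorm (fun x => A.contract (hess u x)) 2 volume := by
    intro u
    have h1 := u.isW22Star.mul_eLpNorm_hess_le (by omega) hν hA
    have h2 : (c : ℝ≥0∞) = (ENNReal.ofReal ν)⁻¹ := by
      rw [← ENNReal.ofReal_inv_of_pos hν, ← ENNReal.ofReal_coe_nnreal]
      rfl
    rw [h2, ← ENNReal.div_eq_inv_mul, ENNReal.le_div_iff_mul_le (by simp [hν]) (by simp), mul_comm]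
    exact h1
  refine ⟨C₂ * c, C₁ * c, c, fun u => ⟨?_, ?_, ?_⟩⟩
  · refine norm_toLp_le_of_eLpNorm_le (u.memLp _) (memLp_contract (u.memLp_hess 2))
      ((hC u).2.trans ?_)
    rw [ENNReal.coe_mul, mul_assoc]
    exact mul_le_mul_right (hhess u) _
  · refine norm_toLp_le_of_eLpNorm_le (u.memLp_grad _) (memLp_contract (u.memLp_hess 2))
      ((hC u).1.trans ?_)
    rw [ENNReal.coe_mul, mul_assoc]
    exact mul_le_mul_right (hhess u) _
  · exact norm_toLp_le_of_eLpNorm_le (u.memLp_hess 2) (memLp_contract (u.memLp_hess 2)) (hhess u)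

theorem isW22Star_of_tendsto [Fact (1 ≤ twoStar n)] [Fact (1 ≤ twoStarStar n)]
    {u : ℕ → VectorTest N n}
    {u₀ : Lp (α := EuclideanSpace ℝ (Fin n)) (EuclideanSpace ℝ (Fin N)) (twoStarStar n)}
    {G : Lp (α := EuclideanSpace ℝ (Fin n)) (EuclideanSpace ℝ (Fin N × Fin n)) (twoStar n)}
    {H : Lp (α := EuclideanSpace ℝ (Fin n)) (symTensor N n) 2}
    (hu₀ : Filter.Tendsto (fun k => funLp (twoStarStar n) (u k)) Filter.atTop (nhds u₀))
    (hG : Filter.Tendsto (fun k => gradLp (twoStar n) (u k)) Filter.atTop (nhds G))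
    (hH : Filter.Tendsto (fun k => hessLp 2 (u k)) Filter.atTop (nhds H)) :
    IsW22Star u₀ G H := by
  refine ⟨Lp.memLp u₀, Lp.memLp G, Lp.memLp H, fun α i => ?_, fun α i j => ?_⟩
  · refine isWeakPartial_of_tendsto (EuclideanSpace.proj (𝕜 := ℝ) α)
      (EuclideanSpace.proj (𝕜 := ℝ) (α, i)) hu₀ hG fun k φ hφ hc => ?_
    have h := ((u k).isW22Star.weak_grad α i).2.2 φ hφ hc
    refine (integral_congr_ae ?_).trans (h.trans (congrArg Neg.neg (integral_congr_ae ?_)))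
    · filter_upwards [coeFn_funLp (twoStarStar n) (u k)] with x hx
      rw [hx]; rfl
    · filter_upwards [coeFn_gradLp (twoStar n) (u k)] with x hx
      rw [hx]; rfl
  · refine isWeakPartial_of_tendsto (EuclideanSpace.proj (𝕜 := ℝ) (α, i))
      (symTensorCoord α i j) hG hH fun k φ hφ hc => ?_
    have h := ((u k).isW22Star.weak_hess α i j).2.2 φ hφ hc
    refine (integral_congr_ae ?_).trans (h.trans (congrArg Neg.neg (integral_congr_ae ?_)))
    · filter_upwards [coeFn_gradLp (twoStar n) (u k)] with x hx
      rw [hx]; rfl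
    · filter_upwards [coeFn_hessLp 2 (u k)] with x hx
      rw [hx]; rfl

theorem contract_compLpL_hessLp (A : FourTensor N n) (u : VectorTest N n) :
    A.contractCLM.compLpL 2 volume (hessLp 2 u) = A.testOperator u := by
  apply Lp.ext
  filter_upwards [A.coeFn_testOperator u, coeFn_hessLp 2 u,
    A.contractCLM.coeFn_compLpL (p := 2) (μ := volume) (hessLp 2 u)] with x h1 h2 h3
  rw [h1, h3, h2, FourTensor.contractCLM_apply]

end VectorTest

/-- Solvability of `A : D²u = f`: approximate `f` by `A : D²u_k` with test functions `u_k`; by the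
`L²` estimate for `D²u_k` and the Sobolev inequality the `u_k` converge in `W^{2,2}_*`. -/
theorem FourTensor.exists_isW22Star_contract_eq {A : FourTensor N n} {ν : ℝ} (hn : 5 ≤ n)
    (hν : 0 < ν)
    (hA : ∀ (η : EuclideanSpace ℝ (Fin N)) (a : EuclideanSpace ℝ (Fin n)),
      ν * ‖η‖ ^ 2 * ‖a‖ ^ 2 ≤ A.rankOneForm η a) :
    ∃ C : NNReal, ∀ f : EuclideanSpace ℝ (Fin n) → EuclideanSpace ℝ (Fin N), MemLp f 2 volume →
      ∃ u G H, IsW22Star u G H ∧ (fun x => A.contract (H x)) =ᵐ[volume] f ∧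
        w22StarNorm u G H ≤ C * eLpNorm f 2 volume := by
  have : Fact (1 ≤ twoStar n) := ⟨one_le_twoStar hn⟩
  have : Fact (1 ≤ twoStarStar n) := ⟨one_le_twoStarStar hn⟩
  obtain ⟨C₀, C₁, C₂, hC⟩ := VectorTest.exists_norm_le hn hν hA
  refine ⟨C₀ + C₁ + C₂, fun f hf => ?_⟩
  obtain ⟨y, hy, hyf⟩ := mem_closure_iff_seq_limit.1
    (A.denseRange_testOperator (by omega) hν hA hf.toLp)
  choose u hu using hy
  have hlim : Filter.Tendsto (fun k => A.testOperator (u k)) Filter.atTop (nhds hf.toLp) := by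
    simpa only [hu] using hyf
  obtain ⟨u₀, hu₀, hu₀'⟩ := exists_tendsto_toLpLinear (T := (testSubmodule N n).subtype)
    (fun u => VectorTest.memLp u _) (fun u => (hC u).1) hlim
  obtain ⟨G, hG, hG'⟩ := exists_tendsto_toLpLinear (T := VectorTest.grad)
    (fun u => VectorTest.memLp_grad u _) (fun u => (hC u).2.1) hlim
  obtain ⟨H, hH, hH'⟩ := exists_tendsto_toLpLinear (T := VectorTest.hess)
    (fun u => VectorTest.memLp_hess u 2) (fun u => (hC u).2.2) hlim
  have hAH : A.contractCLM.compLpL 2 volume H = hf.toLp := by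
    refine tendsto_nhds_unique
      (((A.contractCLM.compLpL 2 volume).continuous.tendsto H).comp hH) (hlim.congr fun k => ?_)
    exact (VectorTest.contract_compLpL_hessLp A (u k)).symm
  refine ⟨u₀, G, H, VectorTest.isW22Star_of_tendsto hu₀ hG hH, ?_, ?_⟩
  · filter_upwards [hf.coeFn_toLp, A.contractCLM.coeFn_compLpL (p := 2) (μ := volume) H]
      with x h1 h2
    rw [← h1, ← hAH, h2, FourTensor.contractCLM_apply]
  · have k₀ := eLpNorm_le_of_norm_le hu₀'
    have k₁ := eLpNorm_le_of_norm_le hG'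
    have k₂ := eLpNorm_le_of_norm_le hH'
    rw [eLpNorm_congr_ae hf.coeFn_toLp] at k₀ k₁ k₂
    rw [w22StarNorm, ENNReal.coe_add, ENNReal.coe_add, add_mul, add_mul]
    exact add_le_add (add_le_add k₀ k₁) k₂

end Linear

/-! ### Functions with vanishing weak gradient -/

section Liouville

variable {n : ℕ}

theorem IsWeakPartial.sub {i : Fin n} {u v g h : EuclideanSpace ℝ (Fin n) → ℝ}
    (hu : IsWeakPartial i u g) (hv : IsWeakPartial i v h) :
    IsWeakPartial i (fun x => u x - v x) (fun x => g x - h x) := by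
  refine ⟨hu.1.sub hv.1, hu.2.1.sub hv.2.1, fun φ hφ hc => ?_⟩
  have int : ∀ {f : EuclideanSpace ℝ (Fin n) → ℝ} {ψ : EuclideanSpace ℝ (Fin n) → ℝ},
      LocallyIntegrable f volume → Continuous ψ → HasCompactSupport ψ →
      Integrable (fun x => f x * ψ x) volume := fun {f ψ} hf hψ hψc => by
    simpa only [smul_eq_mul, mul_comm] using
      hf.integrable_smul_left_of_hasCompactSupport hψ hψc
  have hd : Continuous (partialDeriv i φ) := (hφ.partialDeriv i).continuous
  have hdc : HasCompactSupport (partialDeriv i φ) := hc.partialDeriv i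
  simp only [sub_mul]
  have e1 := integral_sub (int hu.1 hd hdc) (int hv.1 hd hdc)
  have e2 := integral_sub (int hu.2.1 hφ.continuous hc) (int hv.2.1 hφ.continuous hc)
  refine e1.trans ?_
  rw [e2]
  have h1 : ∫ x, u x * partialDeriv i φ x = _ := hu.2.2 φ hφ hc
  have h2 : ∫ x, v x * partialDeriv i φ x = _ := hv.2.2 φ hφ hc
  rw [h1, h2]
  ring

/-- The convolution `y ↦ ∫ g(x) φ(y - x) dx` is constant when `g` has vanishing weak
gradient. -/
theorem integral_translate_eq_of_weakPartial_eq_zero {g : EuclideanSpace ℝ (Fin n) → ℝ}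
    (hg : LocallyIntegrable g volume)
    (h : ∀ i, ∀ φ : EuclideanSpace ℝ (Fin n) → ℝ, ContDiff ℝ ∞ φ → HasCompactSupport φ →
      ∫ x, g x * partialDeriv i φ x = 0)
    {φ : EuclideanSpace ℝ (Fin n) → ℝ} (hφ : ContDiff ℝ ∞ φ) (hc : HasCompactSupport φ)
    (y z : EuclideanSpace ℝ (Fin n)) :
    ∫ x, g x * φ (y - x) = ∫ x, g x * φ (z - x) := by
  let L : ℝ →L[ℝ] ℝ →L[ℝ] ℝ := ContinuousLinearMap.mul ℝ ℝ
  have hd := hc.hasFDerivAt_convolution_right L hg (hφ.of_le (by simp) : ContDiff ℝ 1 φ)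
  have hpd : ∀ w i, partialDeriv i (convolution g φ L volume) w = 0 := by
    intro w i
    have hex := (hc.fderiv ℝ).convolutionExists_right (L.precompR (EuclideanSpace ℝ (Fin n))) hg
      (hφ.continuous_fderiv (by simp)) w
    have h1 : partialDeriv i (convolution g φ L volume) w =
        ∫ x, g x * partialDeriv i φ (w - x) := by
      rw [partialDeriv, (hd w).fderiv]
      exact ContinuousLinearMap.integral_apply hex _
    have hs : ContDiff ℝ ∞ fun x : EuclideanSpace ℝ (Fin n) => w - x :=
      contDiff_const.sub contDiff_id
    have h2 := h i (fun x => φ (w - x)) (hφ.comp hs)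
      (hc.comp_homeomorph (Homeomorph.subLeft w))
    have h3 : partialDeriv i (fun x => φ (w - x)) = fun x => -partialDeriv i φ (w - x) := by
      funext x
      have := ((hφ.differentiable (by simp) (w - x)).hasFDerivAt).comp x
        ((hasFDerivAt_id x).const_sub w)
      have h4 : fderiv ℝ (fun x => φ (w - x)) x = _ := this.fderiv
      simp [partialDeriv, h4]
    rw [h3] at h2
    simp only [mul_neg, integral_neg, neg_eq_zero] at h2
    rw [h1, h2]
  have hf : ∀ w, fderiv ℝ (convolution g φ L volume) w = 0 := fun w => by
    have := norm_fderiv_le_of_partialDeriv (convolution g φ L volume) w le_rfl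
      (fun j => by rw [hpd w j, norm_zero])
    rw [mul_zero] at this
    exact norm_le_zero_iff.1 this
  exact is_const_of_fderiv_eq_zero (fun w => (hd w).differentiableAt) hf y z

/-- An `L^p` function on `ℝⁿ` with `p < ∞` and vanishing weak gradient is zero: its pairing with a
test function is unchanged when the test function is moved to infinity. -/
theorem ae_eq_zero_of_weakPartial_eq_zero (hn : 0 < n) {p : ℝ≥0∞} (hp1 : 1 ≤ p) (hp : p ≠ ⊤)
    {g : EuclideanSpace ℝ (Fin n) → ℝ} (hg : MemLp g p volume)
    (h : ∀ i, ∀ φ : EuclideanSpace ℝ (Fin n) → ℝ, ContDiff ℝ ∞ φ → HasCompactSupport φ →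
      ∫ x, g x * partialDeriv i φ x = 0) : g =ᵐ[volume] 0 := by
  have : Fact (1 ≤ p) := ⟨hp1⟩
  have : Nontrivial (EuclideanSpace ℝ (Fin n)) := by
    have : Nonempty (Fin n) := ⟨⟨0, hn⟩⟩
    infer_instance
  have hloc : LocallyIntegrable g volume := hg.locallyIntegrable hp1
  refine ae_eq_zero_of_integral_contDiff_smul_eq_zero hloc fun ψ hψ hψc => ?_
  let φ : EuclideanSpace ℝ (Fin n) → ℝ := fun x => ψ (-x)
  have hφ : ContDiff ℝ ∞ φ := hψ.comp contDiff_neg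
  have hc : HasCompactSupport φ := hψc.comp_homeomorph (Homeomorph.neg _)
  let q := ENNReal.conjExponent p
  have hφq : MemLp φ q volume := hφ.continuous.memLp_of_hasCompactSupport hc
  have hconst : ∀ y, ∫ x, ψ x • g x = ∫ x, g x * φ (y - x) := by
    intro y
    rw [← integral_translate_eq_of_weakPartial_eq_zero hloc h hφ hc 0 y]
    simp [φ, mul_comm]
  have hbound : ∀ ε : ℝ≥0∞, ε ≠ 0 →
      ‖∫ x, ψ x • g x‖ₑ ≤ ε * eLpNorm φ q volume := by
    intro ε hε
    obtain ⟨g', hg'c, hg'ε, hg'cont, hg'm⟩ := hg.exists_hasCompactSupport_eLpNorm_sub_le hp hε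
    obtain ⟨R₁, hR₁⟩ := hg'c.isCompact.isBounded.exists_norm_le
    obtain ⟨R₂, hR₂⟩ := hc.isCompact.isBounded.exists_norm_le
    obtain ⟨y, hy⟩ := NormedSpace.exists_lt_norm ℝ (EuclideanSpace ℝ (Fin n)) (R₁ + R₂)
    have hdisj : ∀ x, g' x * φ (y - x) = 0 := by
      intro x
      by_contra hne
      have h1 := hR₁ x (subset_tsupport _ (left_ne_zero_of_mul hne))
      have h2 := hR₂ (y - x) (subset_tsupport _ (right_ne_zero_of_mul hne))
      have h3 := norm_add_le x (y - x)
      rw [add_sub_cancel] at h3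
      linarith
    have hmp : MeasurePreserving (fun x : EuclideanSpace ℝ (Fin n) => y - x) volume volume :=
      Measure.measurePreserving_sub_left volume y
    have h1 : ∫ x, ψ x • g x = ∫ x, (g - g') x • φ (y - x) := by
      rw [hconst y]
      refine integral_congr_ae (Filter.Eventually.of_forall fun x => ?_)
      simp [sub_mul, hdisj]
    have h2 := eLpNorm_smul_le_mul_eLpNorm (p := p) (q := q) (r := 1)
      (hφq.1.comp_measurePreserving hmp) (hg.sub hg'm).1
    rw [eLpNorm_comp_measurePreserving hφq.1 hmp] at h2
    rw [h1]
    refine (enorm_integral_le_lintegral_enorm _).trans ?_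
    rw [eLpNorm_one_eq_lintegral_enorm] at h2
    exact h2.trans (mul_le_mul_left hg'ε _)
  have hzero : ‖∫ x, ψ x • g x‖ₑ = 0 := by
    by_contra hne
    have hfin := hφq.2.ne
    set a := ‖∫ x, ψ x • g x‖ₑ with ha
    have hatop : a ≠ ⊤ := enorm_ne_top
    have hpos : eLpNorm φ q volume + 1 ≠ 0 := by simp
    have hb := hbound (a / 2 / (eLpNorm φ q volume + 1)) (by
      simp [ENNReal.div_eq_zero_iff, hne, hfin])
    have h3 : a / 2 / (eLpNorm φ q volume + 1) * eLpNorm φ q volume ≤ a / 2 := by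
      refine (mul_le_mul_right (le_self_add (b := 1)) _).trans ?_
      rw [ENNReal.div_mul_cancel hpos (by simp [hfin])]
    exact absurd (hb.trans h3) (not_le.2 (ENNReal.half_lt_self hne hatop))
  simpa using hzero

end Liouville

/-! ### The a priori estimate on `W^{2,2}_*` -/

section APriori

variable {N n : ℕ}

theorem IsW22Star.sub {u v : EuclideanSpace ℝ (Fin n) → EuclideanSpace ℝ (Fin N)} {G K}
    {H J : EuclideanSpace ℝ (Fin n) → symTensor N n} (hu : IsW22Star u G H)
    (hv : IsW22Star v K J) : IsW22Star (u - v) (G - K) (H - J) where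
  memLp_fun := hu.memLp_fun.sub hv.memLp_fun
  memLp_grad := hu.memLp_grad.sub hv.memLp_grad
  memLp_hess := hu.memLp_hess.sub hv.memLp_hess
  weak_grad α i := (hu.weak_grad α i).sub (hv.weak_grad α i)
  weak_hess α i j := (hu.weak_hess α i j).sub (hv.weak_hess α i j)

theorem twoStar_ne_top : twoStar n ≠ ⊤ := ENNReal.ofReal_ne_top

theorem twoStarStar_ne_top : twoStarStar n ≠ ⊤ := ENNReal.ofReal_ne_top

theorem IsW22Star.ae_eq_zero_of_hess {u G} {H : EuclideanSpace ℝ (Fin n) → symTensor N n}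
    (hn : 5 ≤ n) (hu : IsW22Star u G H) (hH : H =ᵐ[volume] 0) :
    u =ᵐ[volume] 0 ∧ G =ᵐ[volume] 0 := by
  have hG : G =ᵐ[volume] 0 := by
    have h1 : ∀ s, (fun x => G x s) =ᵐ[volume] 0 := fun s => by
      refine ae_eq_zero_of_weakPartial_eq_zero (by omega) (one_le_twoStar hn) twoStar_ne_top
        (hu.memLp_grad.eval_piLp s) fun j φ hφ hc => ?_
      refine ((hu.weak_hess s.1 s.2 j).2.2 φ hφ hc).trans ?_
      rw [neg_eq_zero]
      refine integral_eq_zero_of_ae ?_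
      filter_upwards [hH] with x hx
      simp [hx]
    filter_upwards [ae_all_iff.2 h1] with x hx
    ext s
    exact hx s
  refine ⟨?_, hG⟩
  have h1 : ∀ α, (fun x => u x α) =ᵐ[volume] 0 := fun α => by
    refine ae_eq_zero_of_weakPartial_eq_zero (by omega) (one_le_twoStarStar hn) twoStarStar_ne_top
      (hu.memLp_fun.eval_piLp α) fun i φ hφ hc => ?_
    refine ((hu.weak_grad α i).2.2 φ hφ hc).trans ?_
    rw [neg_eq_zero]
    refine integral_eq_zero_of_ae ?_
    filter_upwards [hG] with x hx
    simp [hx]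
  filter_upwards [ae_all_iff.2 h1] with x hx
  ext s
  exact hx s

/-- Elements of `W^{2,2}_*` with the same `A : D²u` coincide. -/
theorem IsW22Star.ae_eq_of_contract_ae_eq {A : FourTensor N n} {ν : ℝ} (hn : 5 ≤ n) (hν : 0 < ν)
    (hA : ∀ (η : EuclideanSpace ℝ (Fin N)) (a : EuclideanSpace ℝ (Fin n)),
      ν * ‖η‖ ^ 2 * ‖a‖ ^ 2 ≤ A.rankOneForm η a)
    {u v G K} {H J : EuclideanSpace ℝ (Fin n) → symTensor N n} (hu : IsW22Star u G H)
    (hv : IsW22Star v K J)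
    (h : (fun x => A.contract (H x)) =ᵐ[volume] fun x => A.contract (J x)) :
    u =ᵐ[volume] v ∧ G =ᵐ[volume] K ∧ H =ᵐ[volume] J := by
  have hs := hu.sub hv
  have h0 : eLpNorm (fun x => A.contract ((H - J) x)) 2 volume = 0 := by
    have : (fun x => A.contract ((H - J) x)) =ᵐ[volume] 0 := by
      filter_upwards [h] with x hx
      have := A.contractCLM.map_sub (H x) (J x)
      simp only [FourTensor.contractCLM_apply] at this
      simp only [Pi.sub_apply, this, hx, sub_self, Pi.zero_apply]
    rw [eLpNorm_congr_ae this, eLpNorm_zero]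
  have h1 := hs.mul_eLpNorm_hess_le (by omega) hν hA
  rw [h0, nonpos_iff_eq_zero, mul_eq_zero] at h1
  have h2 : eLpNorm (H - J) 2 volume = 0 := h1.resolve_left (by simp [hν])
  have h3 : H - J =ᵐ[volume] 0 := (eLpNorm_eq_zero_iff hs.memLp_hess.1 two_ne_zero).1 h2
  obtain ⟨h4, h5⟩ := hs.ae_eq_zero_of_hess hn h3
  have key : ∀ {V : Type} [NormedAddCommGroup V] {a b : EuclideanSpace ℝ (Fin n) → V},
      a - b =ᵐ[volume] 0 → a =ᵐ[volume] b := fun {V _ a b} hab => by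
    filter_upwards [hab] with x hx
    exact sub_eq_zero.1 hx
  exact ⟨key h4, key h5, key h3⟩

/-- The full `W^{2,2}_*` norm is controlled by `A : D²u`, since `u` coincides with the solution
constructed from test functions. -/
theorem FourTensor.exists_w22StarNorm_le {A : FourTensor N n} {ν : ℝ} (hn : 5 ≤ n) (hν : 0 < ν)
    (hA : ∀ (η : EuclideanSpace ℝ (Fin N)) (a : EuclideanSpace ℝ (Fin n)),
      ν * ‖η‖ ^ 2 * ‖a‖ ^ 2 ≤ A.rankOneForm η a) :
    ∃ C : NNReal, ∀ (u : EuclideanSpace ℝ (Fin n) → EuclideanSpace ℝ (Fin N)) G H,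
      IsW22Star u G H →
      w22StarNorm u G H ≤ C * eLpNorm (fun x => A.contract (H x)) 2 volume := by
  obtain ⟨C, hC⟩ := exists_isW22Star_contract_eq hn hν hA
  refine ⟨C, fun u G H hu => ?_⟩
  obtain ⟨v, K, J, hv, hJ, hle⟩ := hC _ (memLp_contract (A := A) hu.memLp_hess)
  obtain ⟨h1, h2, h3⟩ := hu.ae_eq_of_contract_ae_eq hn hν hA hv hJ.symm
  rwa [w22StarNorm, eLpNorm_congr_ae h1, eLpNorm_congr_ae h2, eLpNorm_congr_ae h3]

end APriori

/-! ### The ellipticity constant -/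

namespace FourTensor

variable {N n : ℕ}

theorem rankOneForm_smul (A : FourTensor N n) (c d : ℝ) (η : EuclideanSpace ℝ (Fin N))
    (a : EuclideanSpace ℝ (Fin n)) :
    A.rankOneForm (c • η) (d • a) = c ^ 2 * d ^ 2 * A.rankOneForm η a := by
  simp only [rankOneForm, Finset.mul_sum, PiLp.smul_apply, smul_eq_mul]
  refine Finset.sum_congr rfl fun α _ => Finset.sum_congr rfl fun β _ =>
    Finset.sum_congr rfl fun i _ => Finset.sum_congr rfl fun j _ => ?_
  ring

theorem RankOnePositive.ellipticityConst_pos {A : FourTensor N n} (hA : A.RankOnePositive)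
    (hN : 0 < N) (hn : 0 < n) : 0 < A.ellipticityConst := by
  obtain ⟨ν, hν, h⟩ := hA
  refine hν.trans_le (le_csInf ?_ ?_)
  · exact ⟨_, EuclideanSpace.single ⟨0, hN⟩ 1, EuclideanSpace.single ⟨0, hn⟩ 1, by simp, by simp,
      rfl⟩
  · rintro q ⟨η, a, hη, ha, rfl⟩
    simpa [hη, ha] using h η a

theorem RankOnePositive.ellipticityConst_mul_le {A : FourTensor N n} (hA : A.RankOnePositive)
    (η : EuclideanSpace ℝ (Fin N)) (a : EuclideanSpace ℝ (Fin n)) :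
    A.ellipticityConst * ‖η‖ ^ 2 * ‖a‖ ^ 2 ≤ A.rankOneForm η a := by
  obtain ⟨ν, hν, h⟩ := hA
  by_cases hη : η = 0
  · simpa [hη] using h η a
  by_cases ha : a = 0
  · simpa [ha] using h η a
  have hη' := norm_ne_zero_iff.2 hη
  have ha' := norm_ne_zero_iff.2 ha
  have h1 : A.ellipticityConst ≤ A.rankOneForm (‖η‖⁻¹ • η) (‖a‖⁻¹ • a) := by
    refine csInf_le ⟨0, ?_⟩ ⟨_, _, ?_, ?_, rfl⟩
    · rintro q ⟨η', a', _, _, rfl⟩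
      exact le_trans (by positivity) (h η' a')
    · rw [norm_smul, norm_inv, norm_norm, inv_mul_cancel₀ hη']
    · rw [norm_smul, norm_inv, norm_norm, inv_mul_cancel₀ ha']
  rw [rankOneForm_smul] at h1
  calc A.ellipticityConst * ‖η‖ ^ 2 * ‖a‖ ^ 2
      ≤ (‖η‖⁻¹ ^ 2 * ‖a‖⁻¹ ^ 2 * A.rankOneForm η a) * ‖η‖ ^ 2 * ‖a‖ ^ 2 := by gcongr
    _ = A.rankOneForm η a := by field_simp

end FourTensor

/-! ### Superposition with Carathéodory maps -/

section Superposition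

variable {N n : ℕ}

/-- Superposition preserves measurability: this is clear for simple functions, and the general case
follows by continuity in the second variable. -/
theorem IsCaratheodory.aestronglyMeasurable_comp
    {F : EuclideanSpace ℝ (Fin n) → symTensor N n → EuclideanSpace ℝ (Fin N)}
    (hF : IsCaratheodory F) {H : EuclideanSpace ℝ (Fin n) → symTensor N n}
    (hH : AEStronglyMeasurable H volume) :
    AEStronglyMeasurable (fun x => F x (H x)) volume := by
  have hsimple : ∀ s : SimpleFunc (EuclideanSpace ℝ (Fin n)) (symTensor N n),
      AEStronglyMeasurable (fun x => F x (s x)) volume := by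
    intro s
    have e : (fun x => F x (s x)) =
        fun x => ∑ y ∈ s.range, (s ⁻¹' {y}).indicator (fun x => F x y) x := by
      funext x
      rw [Finset.sum_eq_single (s x)]
      · simp
      · intro y _ hy
        simp [Set.indicator, Ne.symm hy]
      · intro h
        exact absurd (s.mem_range_self x) h
    rw [e]
    exact Finset.aestronglyMeasurable_fun_sum _ fun y _ =>
      (hF.1 y).indicator (s.measurableSet_fiber y)
  have hm := hH.stronglyMeasurable_mk
  refine AEStronglyMeasurable.congr (f := fun x => F x (hH.mk H x)) ?_ ?_
  · refine aestronglyMeasurable_of_tendsto_ae Filter.atTop (fun k => hsimple (hm.approx k)) ?_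
    filter_upwards [hF.2] with x hx
    exact (hx.tendsto _).comp (hm.tendsto_approx x)
  · filter_upwards [hH.ae_eq_mk] with x hx
    rw [hx]

theorem MeasureTheory.MemLp.exists_ae_norm_le {α : Type*} [MeasurableSpace α] {μ : Measure α}
    {f : α → ℝ} (hf : MemLp f ⊤ μ) : ∃ M : NNReal, ∀ᵐ x ∂μ, ‖f x‖ ≤ M := by
  have hfin : eLpNormEssSup f μ ≠ ⊤ := by
    rw [← eLpNorm_exponent_top]
    exact hf.2.ne
  refine ⟨(eLpNormEssSup f μ).toNNReal, ?_⟩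
  filter_upwards [ae_le_eLpNormEssSup (f := f) (μ := μ)] with x hx
  have := ENNReal.toReal_mono hfin hx
  rwa [toReal_enorm] at this

end Superposition

/-! ### Near operators -/

section Near

variable {N n : ℕ}

/-- The `K`-condition makes superposition with `F` a Lipschitz map of `L²`. -/
theorem memLp_superposition_sub
    {F : EuclideanSpace ℝ (Fin n) → symTensor N n → EuclideanSpace ℝ (Fin N)}
    (hF : IsCaratheodory F) {A : FourTensor N n} {α : EuclideanSpace ℝ (Fin n) → ℝ} {b γ : ℝ}
    (hα0 : ∀ᵐ x ∂volume, 0 < α x) (hα' : MemLp (fun x => 1 / α x) ⊤ volume)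
    (hb : 0 ≤ b) (hγ : 0 ≤ γ)
    (hK : ∀ᵐ x ∂volume, ∀ X Z : symTensor N n,
      ‖A.contract Z - α x • (F x (X + Z) - F x X)‖ ^ 2 ≤ b * ‖Z‖ ^ 2 + γ * ‖A.contract Z‖ ^ 2)
    {H J : EuclideanSpace ℝ (Fin n) → symTensor N n} (hH : MemLp H 2 volume)
    (hJ : MemLp J 2 volume) : MemLp (fun x => F x (H x) - F x (J x)) 2 volume := by
  obtain ⟨M, hM⟩ := hα'.exists_ae_norm_le
  let c := ‖A.contractCLM‖
  refine MemLp.of_le_mul (c := M * (c + Real.sqrt (b + γ * c ^ 2))) (hH.sub hJ)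
    ((hF.aestronglyMeasurable_comp hH.1).sub (hF.aestronglyMeasurable_comp hJ.1)) ?_
  filter_upwards [hα0, hM, hK] with x h0 h1 h2
  set Z := H x - J x with hZ
  set D := F x (H x) - F x (J x) with hD
  have h3 := h2 (J x) Z
  rw [hZ, add_sub_cancel, ← hZ, ← hD] at h3
  have hc : ‖A.contract Z‖ ≤ c * ‖Z‖ := A.contractCLM.le_opNorm Z
  have h4 : ‖A.contract Z - α x • D‖ ≤ Real.sqrt (b + γ * c ^ 2) * ‖Z‖ := by
    refine (sq_le_sq₀ (norm_nonneg _) (by positivity)).1 ?_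
    rw [mul_pow, Real.sq_sqrt (by positivity)]
    calc _ ≤ _ := h3
      _ ≤ b * ‖Z‖ ^ 2 + γ * (c * ‖Z‖) ^ 2 := by gcongr
      _ = _ := by ring
  have h5 : D = (1 / α x) • (A.contract Z - (A.contract Z - α x • D)) := by
    rw [sub_sub_cancel, smul_smul, one_div, inv_mul_cancel₀ h0.ne', one_smul]
  calc ‖D‖ = ‖1 / α x‖ * ‖A.contract Z - (A.contract Z - α x • D)‖ := by
        conv_lhs => rw [h5]
        rw [norm_smul]
    _ ≤ M * (c * ‖Z‖ + Real.sqrt (b + γ * c ^ 2) * ‖Z‖) := by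
        gcongr
        exact (norm_sub_le _ _).trans (add_le_add hc h4)
    _ = M * (c + Real.sqrt (b + γ * c ^ 2)) * ‖Z‖ := by ring

/-- The map `A : D² - α F(·, D²)` is Lipschitz relative to `A : D²`, with constant
`√(β + γ)`: integrate the `K`-condition and use `ν ‖D²u‖ ≤ ‖A : D²u‖`. -/
theorem eLpNorm_contract_sub_le
    {F : EuclideanSpace ℝ (Fin n) → symTensor N n → EuclideanSpace ℝ (Fin N)}
    {A : FourTensor N n} {α : EuclideanSpace ℝ (Fin n) → ℝ} {β γ ν : ℝ} (hn : 0 < n) (hν : 0 < ν)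
    (hA : ∀ (η : EuclideanSpace ℝ (Fin N)) (a : EuclideanSpace ℝ (Fin n)),
      ν * ‖η‖ ^ 2 * ‖a‖ ^ 2 ≤ A.rankOneForm η a)
    (hα : MemLp α ⊤ volume) (hβ : 0 ≤ β) (hγ : 0 ≤ γ)
    (hK : ∀ᵐ x ∂volume, ∀ X Z : symTensor N n,
      ‖A.contract Z - α x • (F x (X + Z) - F x X)‖ ^ 2
        ≤ β * ν ^ 2 * ‖Z‖ ^ 2 + γ * ‖A.contract Z‖ ^ 2)
    {w v G K} {H J : EuclideanSpace ℝ (Fin n) → symTensor N n} (hw : IsW22Star w G H)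
    (hv : IsW22Star v K J) (hD : MemLp (fun x => F x (H x) - F x (J x)) 2 volume) :
    eLpNorm (fun x => A.contract (H x - J x) - α x • (F x (H x) - F x (J x))) 2 volume ≤
      Real.toNNReal (Real.sqrt (β + γ)) *
        eLpNorm (fun x => A.contract (H x - J x)) 2 volume := by
  have hs := hw.sub hv
  have hAm : MemLp (fun x => A.contract (H x - J x)) 2 volume :=
    memLp_contract (A := A) hs.memLp_hess
  have hDm : MemLp (fun x => α x • (F x (H x) - F x (J x))) 2 volume := hD.smul hα
  have hm : MemLp (fun x => A.contract (H x - J x) - α x • (F x (H x) - F x (J x))) 2 volume :=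
    hAm.sub hDm
  have hZ : MemLp (fun x => H x - J x) 2 volume := hs.memLp_hess
  have hest : ENNReal.ofReal ν * eLpNorm (fun x => H x - J x) 2 volume ≤
      eLpNorm (fun x => A.contract (H x - J x)) 2 volume := hs.mul_eLpNorm_hess_le hn hν hA
  have hest' := ENNReal.toReal_mono hAm.2.ne hest
  rw [ENNReal.toReal_mul, ENNReal.toReal_ofReal hν.le] at hest'
  have iZ : Integrable (fun x => ‖H x - J x‖ ^ 2) volume :=
    hZ.integrable_norm_pow (p := 2) two_ne_zero
  have iA : Integrable (fun x => ‖A.contract (H x - J x)‖ ^ 2) volume :=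
    hAm.integrable_norm_pow (p := 2) two_ne_zero
  have iD : Integrable (fun x => ‖A.contract (H x - J x) -
      α x • (F x (H x) - F x (J x))‖ ^ 2) volume := hm.integrable_norm_pow (p := 2) two_ne_zero
  have hint := integral_mono_ae iD ((iZ.const_mul (β * ν ^ 2)).add (iA.const_mul γ)) (by
    filter_upwards [hK] with x hx
    have := hx (J x) (H x - J x)
    rwa [add_sub_cancel] at this)
  have e1 : ∫ x, ((fun x => β * ν ^ 2 * ‖H x - J x‖ ^ 2) +
      fun x => γ * ‖A.contract (H x - J x)‖ ^ 2) x =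
      β * ν ^ 2 * (∫ x, ‖H x - J x‖ ^ 2) + γ * ∫ x, ‖A.contract (H x - J x)‖ ^ 2 := by
    rw [integral_add' (iZ.const_mul _) (iA.const_mul _), integral_const_mul, integral_const_mul]
  rw [e1, integral_norm_sq_eq hZ, integral_norm_sq_eq hAm] at hint
  have hint2 := (integral_norm_sq_eq hm).symm.trans_le hint
  set z := (eLpNorm (fun x => H x - J x) 2 volume).toReal
  set a := (eLpNorm (fun x => A.contract (H x - J x)) 2 volume).toReal with ha
  have hz : 0 ≤ z := ENNReal.toReal_nonneg
  have ha0 : 0 ≤ a := ENNReal.toReal_nonneg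
  have hsq : (ν * z) ^ 2 ≤ a ^ 2 := pow_le_pow_left₀ (by positivity) hest' 2
  have hfinal : (eLpNorm (fun x => A.contract (H x - J x) -
      α x • (F x (H x) - F x (J x))) 2 volume).toReal ≤ Real.sqrt (β + γ) * a := by
    refine (sq_le_sq₀ ENNReal.toReal_nonneg (by positivity)).1 ?_
    rw [mul_pow, Real.sq_sqrt (by positivity)]
    refine hint2.trans ?_
    nlinarith
  rw [← ENNReal.ofReal_toReal hm.2.ne, ← ENNReal.ofReal_toReal hAm.2.ne, ← ha]
  refine (ENNReal.ofReal_le_ofReal hfinal).trans ?_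
  rw [ENNReal.ofReal_mul (Real.sqrt_nonneg _)]
  rfl

/-- Absorption of `κ a` into the left-hand side, which needs `a` to be finite. -/
theorem le_mul_of_le_mul_add {a d : ℝ≥0∞} (ha : a ≠ ⊤) (hd : d ≠ ⊤) {κ M : NNReal} (hκ : κ < 1)
    (h : a ≤ κ * a + M * d) : a ≤ ((1 - κ)⁻¹ * M : NNReal) * d := by
  lift a to NNReal using ha
  lift d to NNReal using hd
  norm_cast at h ⊢
  rw [mul_assoc, ← NNReal.coe_le_coe]
  rw [← NNReal.coe_le_coe] at h
  push_cast [hκ.le] at h ⊢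
  have hk : (0 : ℝ) < 1 - κ := sub_pos.2 (by exact_mod_cast hκ)
  rw [inv_mul_eq_div, le_div_iff₀ hk]
  linarith

/-- Existence: with `u_g` the solution of `A : D²u = g`, the map
`g ↦ A : D²u_g - α (F(·, D²u_g) - f)` is a contraction of `L²`, and its fixed point `g` satisfies
`F(·, D²u_g) = f`. -/
theorem exists_isStrongSolution
    {F : EuclideanSpace ℝ (Fin n) → symTensor N n → EuclideanSpace ℝ (Fin N)}
    {A : FourTensor N n} {α : EuclideanSpace ℝ (Fin n) → ℝ} {κ : NNReal} (hκ : κ < 1)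
    (hα : MemLp α ⊤ volume) (hα0 : ∀ᵐ x ∂volume, 0 < α x)
    (hsolve : ∀ g : EuclideanSpace ℝ (Fin n) → EuclideanSpace ℝ (Fin N), MemLp g 2 volume →
      ∃ u G H, IsW22Star u G H ∧ (fun x => A.contract (H x)) =ᵐ[volume] g)
    (hFm : ∀ {u G H}, IsW22Star (N := N) (n := n) u G H → MemLp (fun x => F x (H x)) 2 volume)
    (hnear : ∀ {w G H v K J}, IsW22Star (N := N) (n := n) w G H → IsW22Star v K J →
      eLpNorm (fun x => A.contract (H x - J x) - α x • (F x (H x) - F x (J x))) 2 volume ≤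
        κ * eLpNorm (fun x => A.contract (H x - J x)) 2 volume)
    {f : EuclideanSpace ℝ (Fin n) → EuclideanSpace ℝ (Fin N)} (hf : MemLp f 2 volume) :
    ∃ u G H, IsStrongSolution F f u G H := by
  choose u G H hW hAH using fun g : Lp (α := EuclideanSpace ℝ (Fin n))
    (EuclideanSpace ℝ (Fin N)) 2 => hsolve g (Lp.memLp g)
  have hm : ∀ g, MemLp (fun x => A.contract (H g x) - α x • (F x (H g x) - f x)) 2 volume :=
    fun g => (memLp_contract (hW g).memLp_hess).sub (((hFm (hW g)).sub hf).smul hα)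
  let T : Lp (α := EuclideanSpace ℝ (Fin n)) (EuclideanSpace ℝ (Fin N)) 2 →
    Lp (α := EuclideanSpace ℝ (Fin n)) (EuclideanSpace ℝ (Fin N)) 2 := fun g => (hm g).toLp
  have hT : ContractingWith κ T := by
    refine ⟨hκ, fun g g' => ?_⟩
    rw [Lp.edist_def, Lp.edist_def]
    have e1 : (T g - T g' : EuclideanSpace ℝ (Fin n) → EuclideanSpace ℝ (Fin N)) =ᵐ[volume]
        fun x => A.contract (H g x - H g' x) - α x • (F x (H g x) - F x (H g' x)) := by
      filter_upwards [(hm g).coeFn_toLp, (hm g').coeFn_toLp] with x h1 h2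
      have h3 := A.contractCLM.map_sub (H g x) (H g' x)
      simp only [FourTensor.contractCLM_apply] at h3
      simp only [Pi.sub_apply, T]
      rw [h1, h2, h3]
      simp only [smul_sub]
      abel
    have e2 : (g - g' : EuclideanSpace ℝ (Fin n) → EuclideanSpace ℝ (Fin N)) =ᵐ[volume]
        fun x => A.contract (H g x - H g' x) := by
      filter_upwards [hAH g, hAH g'] with x h1 h2
      have h3 := A.contractCLM.map_sub (H g x) (H g' x)
      simp only [FourTensor.contractCLM_apply] at h3
      rw [Pi.sub_apply, h3, h1, h2]
    rw [eLpNorm_congr_ae e1, eLpNorm_congr_ae e2]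
    exact hnear (hW g) (hW g')
  have hfix : T (hT.fixedPoint T) = hT.fixedPoint T := hT.fixedPoint_isFixedPt
  set g := hT.fixedPoint T
  refine ⟨u g, G g, H g, hW g, ?_⟩
  filter_upwards [(hm g).coeFn_toLp, hAH g, hα0] with x h1 h2 h3
  have h4 : (T g) x = g x := by rw [hfix]
  have h5 : g x = A.contract (H g x) - α x • (F x (H g x) - f x) := h4.symm.trans h1
  rw [← h2, eq_comm, sub_eq_self, smul_eq_zero] at h5
  exact sub_eq_zero.1 (h5.resolve_left h3.ne')

end Near

end

theorem theorem2 (n N : ℕ) (hn : 5 ≤ n) (hN : 2 ≤ N)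
    (F : EuclideanSpace ℝ (Fin n) → symTensor N n → EuclideanSpace ℝ (Fin N))
    (hF : IsCaratheodory F) (hK : KCondition F) (hF0 : ∀ᵐ x ∂volume, F x 0 = 0) :
    ∃ C : ℝ, 0 < C ∧
      (∀ f : EuclideanSpace ℝ (Fin n) → EuclideanSpace ℝ (Fin N), MemLp f 2 volume →
        ∃ u G H, IsStrongSolution F f u G H ∧
          w22StarNorm u G H ≤ ENNReal.ofReal C * eLpNorm f 2 volume ∧
          ∀ u' G' H', IsStrongSolution F f u' G' H' → u' =ᵐ[volume] u) ∧
      (∀ w Gw Hw v Gv Hv, IsW22Star (N := N) (n := n) w Gw Hw → IsW22Star v Gv Hv →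
        MemLp (fun x => F x (Hw x) - F x (Hv x)) 2 volume ∧
        w22StarNorm (w - v) (Gw - Gv) (Hw - Hv) ≤
          ENNReal.ofReal C * eLpNorm (fun x => F x (Hw x) - F x (Hv x)) 2 volume) := by
  obtain ⟨A, α, β, γ, -, hApos, hα, hα0, hα', hβ, hγ, hβγ, hKx⟩ := hK
  have hν := hApos.ellipticityConst_pos (by omega) (by omega)
  have hA := hApos.ellipticityConst_mul_le
  obtain ⟨C₀, hC₀⟩ := FourTensor.exists_w22StarNorm_le hn hν hA
  obtain ⟨M, hM⟩ := hα.exists_ae_norm_le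
  let κ : NNReal := Real.toNNReal (Real.sqrt (β + γ))
  have hκ1 : κ < 1 := by
    rw [Real.toNNReal_lt_one, Real.sqrt_lt' one_pos, one_pow]
    exact hβγ
  have hDm : ∀ {w Gw Hw v Gv Hv}, IsW22Star (N := N) (n := n) w Gw Hw → IsW22Star v Gv Hv →
      MemLp (fun x => F x (Hw x) - F x (Hv x)) 2 volume := fun hw hv =>
    memLp_superposition_sub hF hα0 hα' (by positivity) hγ.le hKx hw.memLp_hess hv.memLp_hess
  have hnear : ∀ {w Gw Hw v Gv Hv}, IsW22Star (N := N) (n := n) w Gw Hw → IsW22Star v Gv Hv →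
      eLpNorm (fun x => A.contract (Hw x - Hv x) - α x • (F x (Hw x) - F x (Hv x))) 2 volume ≤
        κ * eLpNorm (fun x => A.contract (Hw x - Hv x)) 2 volume := fun hw hv =>
    eLpNorm_contract_sub_le (by omega) hν hA hα hβ.le hγ.le hKx hw hv (hDm hw hv)
  -- the summand `1` keeps `C` positive without a case distinction on `C₀` and `M`
  let C : NNReal := C₀ * ((1 - κ)⁻¹ * M) + 1
  have hmain : ∀ {w Gw Hw v Gv Hv}, IsW22Star (N := N) (n := n) w Gw Hw → IsW22Star v Gv Hv →
      w22StarNorm (w - v) (Gw - Gv) (Hw - Hv) ≤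
        ENNReal.ofReal C * eLpNorm (fun x => F x (Hw x) - F x (Hv x)) 2 volume := by
    intro w Gw Hw v Gv Hv hw hv
    have hs := hw.sub hv
    have hAm : MemLp (fun x => A.contract (Hw x - Hv x)) 2 volume :=
      memLp_contract (A := A) hs.memLp_hess
    have hD := hDm hw hv
    have hαD : MemLp (fun x => α x • (F x (Hw x) - F x (Hv x))) 2 volume := hD.smul hα
    set a := eLpNorm (fun x => A.contract (Hw x - Hv x)) 2 volume
    set d := eLpNorm (fun x => F x (Hw x) - F x (Hv x)) 2 volume
    have h1 : eLpNorm (fun x => α x • (F x (Hw x) - F x (Hv x))) 2 volume ≤ M * d := by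
      refine eLpNorm_le_nnreal_smul_eLpNorm_of_ae_le_mul ?_ 2
      filter_upwards [hM] with x hx
      rw [← NNReal.coe_le_coe]
      push_cast
      rw [norm_smul]
      gcongr
    have h2 : a ≤ κ * a + M * d := by
      have h3 := eLpNorm_add_le (hAm.sub hαD).1 hαD.1 one_le_two
      rw [sub_add_cancel] at h3
      exact h3.trans (add_le_add (hnear hw hv) h1)
    have h4 := le_mul_of_le_mul_add hAm.2.ne hD.2.ne hκ1 h2
    refine (hC₀ _ _ _ hs).trans ?_
    refine (mul_le_mul_right h4 _).trans ?_
    rw [ENNReal.ofReal_coe_nnreal, ← mul_assoc, ← ENNReal.coe_mul]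
    refine mul_le_mul_left ?_ _
    exact ENNReal.coe_le_coe.2 le_self_add
  have hzero : IsW22Star (N := N) (n := n) 0 0 0 := by
    have := (0 : VectorTest N n).isW22Star
    rwa [map_zero, map_zero] at this
  have hF0' : ∀ H : EuclideanSpace ℝ (Fin n) → symTensor N n,
      (fun x => F x (H x) - F x ((0 : EuclideanSpace ℝ (Fin n) → symTensor N n) x)) =ᵐ[volume]
        fun x => F x (H x) := by
    intro H
    filter_upwards [hF0] with x hx
    simp [hx]
  refine ⟨C, by positivity, fun f hf => ?_, fun w Gw Hw v Gv Hv hw hv => ⟨hDm hw hv, hmain hw hv⟩⟩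
  obtain ⟨u, G, H, hu⟩ := exists_isStrongSolution (F := F) (A := A) hκ1 hα hα0
    (fun g hg => by
      obtain ⟨C', hC'⟩ := FourTensor.exists_isW22Star_contract_eq hn hν hA
      obtain ⟨u, G, H, h1, h2, -⟩ := hC' g hg
      exact ⟨u, G, H, h1, h2⟩)
    (fun {u G H} h => (memLp_congr_ae (hF0' H)).1 (hDm h hzero)) hnear hf
  refine ⟨u, G, H, hu, ?_, fun u' G' H' hu' => ?_⟩
  · have h := hmain hu.1 hzero
    rw [sub_zero, sub_zero, sub_zero, eLpNorm_congr_ae ((hF0' H).trans hu.2)] at h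
    exact h
  · have h := hmain hu'.1 hu.1
    have h0 : (fun x => F x (H' x) - F x (H x)) =ᵐ[volume] 0 := by
      filter_upwards [hu'.2, hu.2] with x h1 h2
      rw [h1, h2, sub_self, Pi.zero_apply]
    rw [eLpNorm_congr_ae h0, eLpNorm_zero, mul_zero, nonpos_iff_eq_zero, w22StarNorm,
      add_eq_zero, add_eq_zero] at h
    have hne : twoStarStar n ≠ 0 := (zero_lt_one.trans_le (one_le_twoStarStar hn)).ne'
    have h3 := (eLpNorm_eq_zero_iff (hu'.1.sub hu.1).memLp_fun.1 hne).1 h.1.1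
    filter_upwards [h3] with x hx
    exact sub_eq_zero.1 hx
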